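/- A \emph{topological groupoid} $\mathbb{X}=(X_1\rightrightarrows X_0)$ is a small groupoid whose sets of objects $X_0$ and of arrows $X_1$ carry topologies making source $s$, target $t$, identities, inversion and composition continuous; it is \emph{open} if $s$ is an open map. A continuous functor is a functor that is continuous on objects and on arrows; a continuous transformation $a\colon\Phi\Rightarrow\Psi$ between continuous functors $\mathbb{X}\to\mathbb{Y}$ is a natural transformation for which $X_0\to Y_1$, $x\mapsto a_x$, is continuous. A \emph{sheaf} on $\mathbb{X}$ is a local homeomorphism $q\colon W\to X_0$ with a continuous (unital, associative) action $X_1\times_{X_0}W\to W$, $(g,w)\mapsto g\cdot w$ for $s(g)=q(w)$, with $q(g\cdot w)=t(g)$; morphisms of sheaves are continuous equivariant maps over $X_0$. These form the topos $\mathrm{Sh}(\mathbb{X})$. A continuous functor $\Phi\colon\mathbb{X}\to\mathbb{Y}$ induces a geometric morphism $\mathrm{Sh}(\Phi)\colon\mathrm{Sh}(\mathbb{X})\to\mathrm{Sh}(\mathbb{Y})$ whose inverse image sends $W$ to $\Phi_0^*W=X_0\times_{Y_0}W$ with the action $g\cdot(s(g),w)=(t(g),\Phi_1(g)\cdot w)$,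 and a continuous transformation $a\colon\Phi\Rightarrow\Psi$ induces the natural transformation $\mathrm{Sh}(a)\colon\mathrm{Sh}(\Phi)^*\Rightarrow\mathrm{Sh}(\Psi)^*$, $(x,w)\mapsto(x,a_x\cdot w)$. A space is regarded as a topological groupoid with only identity arrows, and $u_{\mathbb{X}}\colon\mathrm{Sh}(X_0)\to\mathrm{Sh}(\mathbb{X})$ is induced by the identity-on-objects functor $X_0\to\mathbb{X}$. An open topological groupoid $\mathbb{X}$ is \emph{étale complete} if $X_0$ and $X_1$ are sober and the square $$\begin{array}{ccc}\mathrm{Sh}(X_1)&\xrightarrow{\ \mathrm{Sh}(s)\ }&\mathrm{Sh}(X_0)\\ {\scriptstyle\mathrm{Sh}(t)}\downarrow&&\downarrow{\scriptstyle u_{\mathbb{X}}}\\ \mathrm{Sh}(X_0)&\xrightarrow{\ u_{\mathbb{X}}\ }&\mathrm{Sh}(\mathbb{X})\end{array}$$ filled by the canonical isomorphism $u_{\mathbb{X}}\circ\mathrm{Sh}(s)\cong u_{\mathbb{X}}\circ\mathrm{Sh}(t)$, $(g,w)\mapsto(g,g\cdot w)$, is a bi-pullback in the bi-category of Grothendieck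 topoi with enough points, geometric morphisms and natural transformations between inverse image functors. \textbf{Lemma.} Let $\mathbb{X}$ and $\mathbb{Y}$ be étale complete topological groupoids. Then the functor $$\mathrm{Sh}\colon\mathbf{ECTGrpd}(\mathbb{X},\mathbb{Y})\to\mathbf{Topos}^{\mathrm{iso}}_{\mathrm{w.e.p.}}(\mathrm{Sh}(\mathbb{X}),\mathrm{Sh}(\mathbb{Y})),\qquad \Phi\mapsto\mathrm{Sh}(\Phi),\ a\mapsto\mathrm{Sh}(a),$$ from the category of continuous functors $\mathbb{X}\to\mathbb{Y}$ and continuous transformations to the category of geometric morphisms $\mathrm{Sh}(\mathbb{X})\to\mathrm{Sh}(\mathbb{Y})$ and natural isomorphisms between their inverse image functors is full and faithful. That is, for all continuous functors $\Phi,\Psi\colon\mathbb{X}\to\mathbb{Y}$, the map $a\mapsto\mathrm{Sh}(a)$ is a bijection from continuous transformations $\Phi\Rightarrow\Psi$ to natural isomorphisms $\mathrm{Sh}(\Phi)^*\cong\mathrm{Sh}(\Psi)^*$. -/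

import Mathlib

open CategoryTheory CategoryTheory.Limits Topology

universe u

/-- A topological groupoid: a small groupoid with topologies on the set `Obj` of objects and the set
`Arr` of arrows such that all structure maps are continuous.
For `g : x ⟶ y` and `h : y ⟶ z`, the composite `h ∘ g` is `comp g h _`. -/
structure TopGrpd : Type (u + 1) where
  Obj : Type u
  Arr : Type u
  [topObj : TopologicalSpace Obj]
  [topArr : TopologicalSpace Arr]
  src : Arr → Obj
  tgt : Arr → Obj
  one : Obj → Arr
  inv : Arr → Arr
  comp : (g h : Arr) → tgt g = src h → Arr
  src_one : ∀ x, src (one x) = x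
  tgt_one : ∀ x, tgt (one x) = x
  src_inv : ∀ g, src (inv g) = tgt g
  tgt_inv : ∀ g, tgt (inv g) = src g
  src_comp : ∀ g h e, src (comp g h e) = src g
  tgt_comp : ∀ g h e, tgt (comp g h e) = tgt h
  one_comp : ∀ g, comp (one (src g)) g (tgt_one _) = g
  comp_one : ∀ g, comp g (one (tgt g)) (src_one _).symm = g
  assoc : ∀ f g h (e : tgt f = src g) (e' : tgt g = src h),
    comp (comp f g e) h ((tgt_comp f g e).trans e') =
      comp f (comp g h e') (e.trans (src_comp g h e').symm)
  comp_inv : ∀ g, comp g (inv g) (src_inv g).symm = one (src g)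
  inv_comp : ∀ g, comp (inv g) g (tgt_inv g) = one (tgt g)
  continuous_src : Continuous src
  continuous_tgt : Continuous tgt
  continuous_one : Continuous one
  continuous_inv : Continuous inv
  continuous_comp : Continuous
    (fun p : {p : Arr × Arr // tgt p.1 = src p.2} => comp p.1.1 p.1.2 p.2)

attribute [instance] TopGrpd.topObj TopGrpd.topArr
attribute [simp] TopGrpd.src_one TopGrpd.tgt_one TopGrpd.src_inv TopGrpd.tgt_inv TopGrpd.src_comp
  TopGrpd.tgt_comp TopGrpd.one_comp TopGrpd.comp_one TopGrpd.comp_inv TopGrpd.inv_comp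

namespace TopGrpd

/-- A topological groupoid is open if its source map is open. -/
def IsOpenGrpd (X : TopGrpd.{u}) : Prop := IsOpenMap X.src

/-- Continuous functors of topological groupoids. -/
structure ContFunctor (X Y : TopGrpd.{u}) : Type u where
  obj : X.Obj → Y.Obj
  arr : X.Arr → Y.Arr
  src_arr : ∀ g, Y.src (arr g) = obj (X.src g)
  tgt_arr : ∀ g, Y.tgt (arr g) = obj (X.tgt g)
  arr_one : ∀ x, arr (X.one x) = Y.one (obj x)
  arr_comp : ∀ g h (e : X.tgt g = X.src h), arr (X.comp g h e) =
    Y.comp (arr g) (arr h) ((tgt_arr g).trans ((congrArg obj e).trans (src_arr h).symm))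
  continuous_obj : Continuous obj
  continuous_arr : Continuous arr

attribute [simp] ContFunctor.src_arr ContFunctor.tgt_arr ContFunctor.arr_one

/-- The composite `Ψ ∘ Φ` of continuous functors. -/
def ContFunctor.comp {X Y Z : TopGrpd.{u}} (Φ : ContFunctor X Y) (Ψ : ContFunctor Y Z) :
    ContFunctor X Z where
  obj x := Ψ.obj (Φ.obj x)
  arr g := Ψ.arr (Φ.arr g)
  src_arr g := by simp
  tgt_arr g := by simp
  arr_one x := by simp
  arr_comp g h e := by simp only [Φ.arr_comp, Ψ.arr_comp]
  continuous_obj := Ψ.continuous_obj.comp Φ.continuous_obj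
  continuous_arr := Ψ.continuous_arr.comp Φ.continuous_arr

/-- Continuous natural transformations `Φ ⇒ Ψ` between continuous functors. -/
@[ext]
structure ContTrans {X Y : TopGrpd.{u}} (Φ Ψ : ContFunctor X Y) : Type u where
  app : X.Obj → Y.Arr
  src_app : ∀ x, Y.src (app x) = Φ.obj x
  tgt_app : ∀ x, Y.tgt (app x) = Ψ.obj x
  naturality : ∀ g : X.Arr,
    Y.comp (Φ.arr g) (app (X.tgt g)) ((Φ.tgt_arr g).trans (src_app _).symm) =
      Y.comp (app (X.src g)) (Ψ.arr g) ((tgt_app _).trans (Ψ.src_arr g).symm)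
  continuous_app : Continuous app

attribute [simp] ContTrans.src_app ContTrans.tgt_app

section
variable {X Y : TopGrpd.{u}}

lemma comp_congr {g g' h h' : X.Arr} (hg : g = g') (hh : h = h') (e : X.tgt g = X.src h)
    (e' : X.tgt g' = X.src h') : X.comp g h e = X.comp g' h' e' := by
  subst hg hh
  rfl

lemma continuous_comp' {S : Type*} [TopologicalSpace S] {f g : S → X.Arr} (hf : Continuous f)
    (hg : Continuous g) (h : ∀ s, X.tgt (f s) = X.src (g s)) :
    Continuous fun s => X.comp (f s) (g s) (h s) :=
  X.continuous_comp.comp (Continuous.subtype_mk (hf.prodMk hg) h)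

/-- The identity transformation. -/
def ContTrans.id (Φ : ContFunctor X Y) : ContTrans Φ Φ where
  app x := Y.one (Φ.obj x)
  src_app x := by simp
  tgt_app x := by simp
  naturality g := by
    have h1 := Y.comp_one (Φ.arr g)
    have h2 := Y.one_comp (Φ.arr g)
    simp only [Φ.src_arr, Φ.tgt_arr] at h1 h2
    rw [h1, h2]
  continuous_app := Y.continuous_one.comp Φ.continuous_obj

/-- The composite of `a : Φ ⇒ Ψ` and `b : Ψ ⇒ Θ`, with components `b_x ∘ a_x`. -/
def ContTrans.vcomp {Φ Ψ Θ : ContFunctor X Y} (a : ContTrans Φ Ψ) (b : ContTrans Ψ Θ) :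
    ContTrans Φ Θ where
  app x := Y.comp (a.app x) (b.app x) (by simp)
  src_app x := by simp
  tgt_app x := by simp
  naturality g := by
    calc _ = Y.comp (Y.comp (Φ.arr g) (a.app (X.tgt g)) (by simp)) (b.app (X.tgt g)) (by simp) :=
          (Y.assoc _ _ _ _ _).symm
      _ = Y.comp (Y.comp (a.app (X.src g)) (Ψ.arr g) (by simp)) (b.app (X.tgt g)) (by simp) :=
          comp_congr (a.naturality g) rfl _ _
      _ = Y.comp (a.app (X.src g)) (Y.comp (Ψ.arr g) (b.app (X.tgt g)) (by simp)) (by simp) :=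
          Y.assoc _ _ _ _ _
      _ = Y.comp (a.app (X.src g)) (Y.comp (b.app (X.src g)) (Θ.arr g) (by simp)) (by simp) :=
          comp_congr rfl (b.naturality g) _ _
      _ = _ := (Y.assoc _ _ _ _ _).symm
  continuous_app := continuous_comp' a.continuous_app b.continuous_app (fun x => by simp)

/-- The inverse of a continuous transformation. -/
def ContTrans.inv {Φ Ψ : ContFunctor X Y} (a : ContTrans Φ Ψ) : ContTrans Ψ Φ where
  app x := Y.inv (a.app x)
  src_app x := by simp
  tgt_app x := by simp
  naturality g := by
    have key := a.naturality g
    have e1 : Y.comp (Y.comp (Y.inv (a.app (X.src g))) (Y.comp (a.app (X.src g)) (Ψ.arr g)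
        (by simp)) (by simp)) (Y.inv (a.app (X.tgt g))) (by simp) =
        Y.comp (Ψ.arr g) (Y.inv (a.app (X.tgt g))) (by simp) := by
      simp only [← Y.assoc _ _ _ (Y.tgt_inv _) _, Y.inv_comp]
      have := Y.one_comp (Ψ.arr g)
      simp only [Ψ.src_arr] at this
      simp [this]
    rw [← e1]
    simp only [← key]
    rw [Y.assoc _ _ _ (by simp) (by simp)]
    simp only [Y.assoc _ _ _ _ (Y.src_inv _).symm, Y.comp_inv]
    have := Y.comp_one (Φ.arr g)
    simp only [Φ.tgt_arr] at this
    simp [this]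
  continuous_app := Y.continuous_inv.comp a.continuous_app

/-- The category `TopGrpd(X, Y)` of continuous functors and continuous transformations. -/
instance : Category.{u} (ContFunctor X Y) where
  Hom Φ Ψ := ContTrans Φ Ψ
  id Φ := ContTrans.id Φ
  comp a b := ContTrans.vcomp a b
  id_comp {Φ Ψ} a := by
    apply ContTrans.ext
    funext x
    have := Y.one_comp (a.app x)
    simp only [a.src_app] at this
    exact this
  comp_id {Φ Ψ} a := by
    apply ContTrans.ext
    funext x
    have := Y.comp_one (a.app x)
    simp only [a.tgt_app] at this
    exact this
  assoc a b c := by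
    apply ContTrans.ext
    funext x
    exact Y.assoc _ _ _ _ _

/-- All continuous transformations are invertible, because `Y` is a groupoid. -/
instance : Groupoid.{u} (ContFunctor X Y) where
  inv {Φ Ψ} a := ContTrans.inv (Φ := Φ) (Ψ := Ψ) a
  inv_comp {Φ Ψ} a := by
    apply ContTrans.ext
    funext x
    exact (Y.inv_comp _).trans (congrArg Y.one (ContTrans.tgt_app (Φ := Φ) (Ψ := Ψ) a x))
  comp_inv {Φ Ψ} a := by
    apply ContTrans.ext
    funext x
    exact (Y.comp_inv _).trans (congrArg Y.one (ContTrans.src_app (Φ := Φ) (Ψ := Ψ) a x))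

end

/-- The structure of a sheaf over the topological groupoid `X` on a space `W`: a local
homeomorphism to the space of objects and a continuous action of the arrows. -/
structure SheafStr (X : TopGrpd.{u}) (W : Type u) [TopologicalSpace W] : Type u where
  proj : W → X.Obj
  isLocalHomeomorph_proj : IsLocalHomeomorph proj
  act : (g : X.Arr) → (w : W) → X.src g = proj w → W
  continuous_act : Continuous
    (fun p : {p : X.Arr × W // X.src p.1 = proj p.2} => act p.1.1 p.1.2 p.2)
  proj_act : ∀ g w e, proj (act g w e) = X.tgt g
  act_one : ∀ w, act (X.one (proj w)) w (X.src_one _) = w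
  act_comp : ∀ g h w (e : X.src g = proj w) (e' : X.tgt g = X.src h),
    act h (act g w e) (e'.symm.trans (proj_act g w e).symm) =
      act (X.comp g h e') w ((X.src_comp g h e').trans e)

/-- Sheaves on a topological groupoid. -/
structure Sh (X : TopGrpd.{u}) : Type (u + 1) where
  carrier : Type u
  [top : TopologicalSpace carrier]
  str : SheafStr X carrier

attribute [instance] Sh.top
attribute [simp] SheafStr.proj_act SheafStr.act_one

namespace Sh

variable {X Y Z : TopGrpd.{u}}

instance : CoeSort (Sh X) (Type u) := ⟨Sh.carrier⟩

abbrev proj (W : Sh X) : W → X.Obj := W.str.proj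

abbrev act (W : Sh X) (g : X.Arr) (w : W) (e : X.src g = W.proj w) : W := W.str.act g w e

/-- Morphisms of sheaves: continuous equivariant maps over the space of objects. -/
@[ext]
structure Hom (V W : Sh X) : Type u where
  toFun : V → W
  continuous_toFun : Continuous toFun
  proj_toFun : ∀ v, W.proj (toFun v) = V.proj v
  map_act : ∀ g v (e : X.src g = V.proj v),
    toFun (V.act g v e) = W.act g (toFun v) (e.trans (proj_toFun v).symm)

attribute [simp] Hom.proj_toFun

/-- The category `Sh(X)` of sheaves on a topological groupoid. -/
instance : Category.{u} (Sh X) where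
  Hom V W := Hom V W
  id V := ⟨fun v => v, continuous_id, fun _ => rfl, fun _ _ _ => rfl⟩
  comp {U V W} f g := ⟨fun v => g.toFun (f.toFun v), g.continuous_toFun.comp f.continuous_toFun,
    fun v => by simp, fun k v e => by simp [f.map_act, g.map_act]⟩

@[ext]
lemma hom_ext {V W : Sh X} {f g : V ⟶ W} (h : ∀ v, Hom.toFun f v = Hom.toFun g v) : f = g :=
  Hom.ext (funext h)

@[simp] lemma id_toFun (V : Sh X) (v : V) : Hom.toFun (𝟙 V) v = v := rfl
@[simp] lemma comp_toFun {U V W : Sh X} (f : U ⟶ V) (g : V ⟶ W) (v : U) :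
    Hom.toFun (f ≫ g) v = Hom.toFun g (Hom.toFun f v) := rfl

lemma continuous_act' (W : Sh X) {S : Type*} [TopologicalSpace S] {f : S → X.Arr} {k : S → W}
    (hf : Continuous f) (hk : Continuous k) (h : ∀ s, X.src (f s) = W.proj (k s)) :
    Continuous fun s => W.act (f s) (k s) (h s) :=
  W.str.continuous_act.comp (Continuous.subtype_mk (hf.prodMk hk) h)

lemma continuous_proj (W : Sh X) : Continuous W.proj := W.str.isLocalHomeomorph_proj.continuous

lemma isLocalHomeomorph_of {A B : Type*} [TopologicalSpace A] [TopologicalSpace B] {f : A → B}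
    (hc : Continuous f) (ho : IsOpenMap f) (hi : IsLocallyInjective f) : IsLocalHomeomorph f := by
  rw [isLocalHomeomorph_iff_isOpenEmbedding_restrict]
  intro a
  obtain ⟨U, hU, ha, hinj⟩ := hi a
  refine ⟨U, hU.mem_nhds ha, .of_continuous_injective_isOpenMap
    (hc.comp continuous_subtype_val) (Set.injOn_iff_injective.mp hinj) ?_⟩
  exact ho.comp hU.isOpenMap_subtype_val

/-- The space `A ×_B W` over `A` is étale if `W` is étale over `B`. -/
lemma isLocalHomeomorph_pullback {A B W : Type*} [TopologicalSpace A] [TopologicalSpace B]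
    [TopologicalSpace W] {f : A → B} {q : W → B} (hf : Continuous f) (hq : IsLocalHomeomorph q) :
    IsLocalHomeomorph (fun p : {p : A × W // f p.1 = q p.2} => p.1.1) := by
  refine isLocalHomeomorph_of (by fun_prop) ?_ ?_
  · rw [isOpenMap_iff_nhds_le]
    rintro ⟨⟨a, w⟩, h⟩
    simp only at h
    intro S hS
    rw [Filter.mem_map, nhds_subtype_eq_comap, Filter.mem_comap] at hS
    obtain ⟨T, hT, hTS⟩ := hS
    rw [nhds_prod_eq, Filter.mem_prod_iff] at hT
    obtain ⟨U, hU, V, hV, hUV⟩ := hT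
    have h1 : q '' V ∈ 𝓝 (f a) := by
      rw [h]; exact hq.isOpenMap.image_mem_nhds hV
    filter_upwards [hU, hf.continuousAt.preimage_mem_nhds h1] with b hb hb'
    obtain ⟨v, hv, hv'⟩ := hb'
    exact hTS (show (⟨(b, v), hv'.symm⟩ : {p : A × W // f p.1 = q p.2}) ∈ _ from
      hUV ⟨hb, hv⟩)
  · rintro ⟨⟨a, w⟩, h⟩
    obtain ⟨U, hU, hw, hinj⟩ := hq.isLocallyInjective w
    refine ⟨{p | p.1.2 ∈ U}, hU.preimage (by fun_prop), hw, ?_⟩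
    rintro ⟨⟨a1, w1⟩, h1⟩ hm1 ⟨⟨a2, w2⟩, h2⟩ hm2 heq
    simp only at heq h1 h2
    subst heq
    have := hinj hm1 hm2 (h1.symm.trans h2)
    simp only at this
    subst this
    rfl

/-- The inverse image `Φ₀^* W` of a sheaf along a continuous functor, with the action
`g · (s(g), w) = (t(g), Φ₁(g) · w)`. -/
def invObj (Φ : ContFunctor X Y) (W : Sh Y) : Sh X where
  carrier := {p : X.Obj × W // Φ.obj p.1 = W.proj p.2}
  str :=
    { proj := fun p => p.1.1
      isLocalHomeomorph_proj :=
        isLocalHomeomorph_pullback Φ.continuous_obj W.str.isLocalHomeomorph_proj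
      act := fun g p e => ⟨(X.tgt g, W.act (Φ.arr g) p.1.2
        ((Φ.src_arr g).trans ((congrArg Φ.obj e).trans p.2))), by simp⟩
      continuous_act := by
        refine Continuous.subtype_mk (.prodMk ?_ ?_) _
        · exact X.continuous_tgt.comp (by fun_prop)
        · exact W.continuous_act' (Φ.continuous_arr.comp (by fun_prop)) (by fun_prop) _
      proj_act := fun _ _ _ => rfl
      act_one := by
        rintro ⟨⟨x, w⟩, h⟩
        simp only at h
        simp [h]
      act_comp := by
        rintro g h ⟨⟨x, w⟩, e0⟩ e e'
        apply Subtype.ext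
        refine Prod.ext (by simp) ?_
        simp only [Φ.arr_comp]
        exact W.str.act_comp _ _ _ _ _ }

/-- The inverse image functor `Sh(Φ)^* : Sh(Y) ⥤ Sh(X)` of a continuous functor `Φ : X → Y`. -/
def inverseImage (Φ : ContFunctor X Y) : Sh Y ⥤ Sh X where
  obj W := invObj Φ W
  map {V W} f :=
    { toFun p := ⟨(p.1.1, Hom.toFun f p.1.2), p.2.trans (Hom.proj_toFun f _).symm⟩
      continuous_toFun := by
        refine Continuous.subtype_mk (.prodMk (by fun_prop) ?_) _
        exact (Hom.continuous_toFun f).comp (by fun_prop)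
      proj_toFun _ := rfl
      map_act g p e := by
        apply Subtype.ext
        exact Prod.ext rfl (Hom.map_act f _ _ _) }

/-- The natural transformation `Sh(a) : Sh(Φ)^* ⟶ Sh(Ψ)^*`, `(x, w) ↦ (x, a_x · w)`, induced by a
continuous transformation `a : Φ ⇒ Ψ`. -/
def inverseImageMap {Φ Ψ : ContFunctor X Y} (a : ContTrans Φ Ψ) : inverseImage Φ ⟶ inverseImage Ψ where
  app W :=
    { toFun p := ⟨(p.1.1, W.act (a.app p.1.1) p.1.2
        ((a.src_app _).trans p.2)), by simp⟩
      continuous_toFun := by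
        refine Continuous.subtype_mk (.prodMk (by fun_prop) ?_) _
        exact W.continuous_act' (a.continuous_app.comp (by fun_prop)) (by fun_prop) _
      proj_toFun _ := rfl
      map_act g p e := by
        apply Subtype.ext
        refine Prod.ext rfl ?_
        change W.str.act _ (W.str.act _ _ _) _ = W.str.act _ (W.str.act _ _ _) _
        obtain ⟨⟨x, w⟩, h⟩ := p
        change X.src g = x at e
        subst e
        rw [W.str.act_comp _ _ _ _ (by simp; rfl), W.str.act_comp _ _ _ _ (by simp)]
        simp only [← a.naturality]
        rfl }
  naturality V W f := by
    apply hom_ext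
    intro p
    apply Subtype.ext
    exact Prod.ext rfl (Hom.map_act f _ _ _).symm

/-- The canonical isomorphism `Sh(Φ)^* Sh(Ψ)^* ≅ Sh(Ψ ∘ Φ)^*`. -/
def inverseImageComp (Φ : ContFunctor X Y) (Ψ : ContFunctor Y Z) :
    inverseImage Ψ ⋙ inverseImage Φ ≅ inverseImage (Φ.comp Ψ) :=
  NatIso.ofComponents (fun W =>
    { hom :=
        { toFun p := ⟨(p.1.1, p.1.2.1.2), (congrArg Ψ.obj p.2).trans p.1.2.2⟩
          continuous_toFun := by
            refine Continuous.subtype_mk (.prodMk (by fun_prop) ?_) _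
            exact continuous_snd.comp (continuous_subtype_val.comp
              (continuous_snd.comp continuous_subtype_val))
          proj_toFun _ := rfl
          map_act _ _ _ := rfl }
      inv :=
        { toFun p := ⟨(p.1.1, ⟨(Φ.obj p.1.1, p.1.2), p.2⟩), rfl⟩
          continuous_toFun := by
            refine Continuous.subtype_mk (.prodMk (by fun_prop)
              (Continuous.subtype_mk (.prodMk (Φ.continuous_obj.comp (by fun_prop))
                (by fun_prop)) _)) _
          proj_toFun _ := rfl
          map_act g p e := by
            apply Subtype.ext
            refine Prod.ext rfl ?_
            apply Subtype.ext
            exact Prod.ext (Φ.tgt_arr g).symm rfl }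
      hom_inv_id := by
        apply hom_ext
        rintro ⟨⟨x, ⟨⟨y, w⟩, h⟩⟩, h'⟩
        apply Subtype.ext
        refine Prod.ext rfl ?_
        apply Subtype.ext
        exact Prod.ext h' rfl
      inv_hom_id := by
        apply hom_ext
        intro p
        rfl }) (fun f => rfl)

section LeftExact

/-- A morphism of sheaves is a local homeomorphism. -/
lemma Hom.isLocalHomeomorph {A B : Sh X} (f : A ⟶ B) : IsLocalHomeomorph (Hom.toFun f) := by
  refine IsLocalHomeomorph.of_comp (g := B.proj) ?_ B.str.isLocalHomeomorph_proj
    (Hom.continuous_toFun f)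
  have : B.proj ∘ Hom.toFun f = A.proj := funext (Hom.proj_toFun f)
  rw [this]
  exact A.str.isLocalHomeomorph_proj

lemma act_congr (W : Sh X) {g g' : X.Arr} {w w' : W} (hg : g = g') (hw : w = w')
    (e : X.src g = W.proj w) (e' : X.src g' = W.proj w') : W.act g w e = W.act g' w' e' := by
  subst hg hw
  rfl

/-- The terminal sheaf. -/
def terminal (X : TopGrpd.{u}) : Sh X where
  carrier := X.Obj
  str :=
    { proj := fun x => x
      isLocalHomeomorph_proj := (Homeomorph.refl X.Obj).isLocalHomeomorph
      act := fun g _ _ => X.tgt g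
      continuous_act := X.continuous_tgt.comp (by fun_prop)
      proj_act := fun _ _ _ => rfl
      act_one := fun _ => X.tgt_one _
      act_comp := fun _ _ _ _ _ => (X.tgt_comp _ _ _).symm }

/-- A sheaf with bijective projection is terminal. -/
noncomputable def isTerminalOfBijective (T : Sh X) (hT : Function.Bijective T.proj) :
    IsTerminal T :=
  let e : T ≃ₜ X.Obj := (Equiv.ofBijective _ hT).toHomeomorphOfContinuousOpen
    T.continuous_proj T.str.isLocalHomeomorph_proj.isOpenMap
  have he : ∀ x, T.proj (e.symm x) = x := fun x => e.apply_symm_apply x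
  IsTerminal.ofUniqueHom (fun W =>
    { toFun w := e.symm (W.proj w)
      continuous_toFun := e.symm.continuous.comp W.continuous_proj
      proj_toFun w := he _
      map_act g w h := by
        apply hT.1
        rw [he]
        simp })
    (fun W m => by
      apply hom_ext
      intro w
      apply hT.1
      exact (Hom.proj_toFun m w).trans (he _).symm)

/-- The fibre product of sheaves. -/
def fibProd {A B C : Sh X} (f : A ⟶ C) (g : B ⟶ C) : Sh X where
  carrier := {p : A × B // Hom.toFun f p.1 = Hom.toFun g p.2}
  str :=
    { proj := fun p => A.proj p.1.1
      isLocalHomeomorph_proj := A.str.isLocalHomeomorph_proj.comp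
        (isLocalHomeomorph_pullback (Hom.continuous_toFun f) (Hom.isLocalHomeomorph g))
      act := fun k p e =>
        have e' : X.src k = B.proj p.1.2 := by
          rw [← Hom.proj_toFun g, ← p.2, Hom.proj_toFun f, e]
        ⟨(A.act k p.1.1 e, B.act k p.1.2 e'), by
          simp only [Hom.map_act]
          exact act_congr _ rfl p.2 _ _⟩
      continuous_act := by
        refine Continuous.subtype_mk (.prodMk ?_ ?_) _
        · exact A.continuous_act' (by fun_prop) (by fun_prop) _
        · exact B.continuous_act' (by fun_prop) (by fun_prop) _
      proj_act := fun _ _ _ => A.str.proj_act _ _ _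
      act_one := by
        rintro ⟨⟨a, b⟩, h⟩
        apply Subtype.ext
        refine Prod.ext (A.str.act_one a) ?_
        refine (act_congr _ (congrArg X.one ?_) rfl _ (X.src_one _)).trans (B.str.act_one b)
        rw [← Hom.proj_toFun g, ← Hom.proj_toFun f, h]
      act_comp := by
        rintro k l ⟨⟨a, b⟩, h⟩ e e'
        apply Subtype.ext
        exact Prod.ext (A.str.act_comp _ _ _ _ _) (B.str.act_comp _ _ _ _ _) }

def fibProdFst {A B C : Sh X} (f : A ⟶ C) (g : B ⟶ C) : fibProd f g ⟶ A where
  toFun p := p.1.1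
  continuous_toFun := by
    exact continuous_fst.comp continuous_subtype_val
  proj_toFun _ := rfl
  map_act _ _ _ := rfl

def fibProdSnd {A B C : Sh X} (f : A ⟶ C) (g : B ⟶ C) : fibProd f g ⟶ B where
  toFun p := p.1.2
  continuous_toFun := by
    exact continuous_snd.comp continuous_subtype_val
  proj_toFun p := by
    change B.proj p.1.2 = A.proj p.1.1
    rw [← Hom.proj_toFun g, ← p.2, Hom.proj_toFun f]
  map_act _ _ _ := rfl

lemma fibProd_w {A B C : Sh X} (f : A ⟶ C) (g : B ⟶ C) :
    fibProdFst f g ≫ f = fibProdSnd f g ≫ g := by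
  apply hom_ext
  intro p
  exact p.2

/-- A commutative square of sheaves that is a pullback on underlying sets is a pullback. -/
lemma isPullback_of_bijective {P A B C : Sh X} {p : P ⟶ A} {q : P ⟶ B} {f : A ⟶ C} {g : B ⟶ C}
    (w : p ≫ f = q ≫ g)
    (hinj : ∀ z z' : P, Hom.toFun p z = Hom.toFun p z' → Hom.toFun q z = Hom.toFun q z' → z = z')
    (hsurj : ∀ (a : A) (b : B), Hom.toFun f a = Hom.toFun g b →
      ∃ z : P, Hom.toFun p z = a ∧ Hom.toFun q z = b) :
    IsPullback p q f g := by
  refine ⟨⟨w⟩, ⟨?_⟩⟩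
  let c : P → fibProd f g := fun z => ⟨(Hom.toFun p z, Hom.toFun q z),
    congrArg (fun m : P ⟶ C => Hom.toFun m z) w⟩
  have hc : Continuous c :=
    Continuous.subtype_mk (.prodMk (Hom.continuous_toFun p) (Hom.continuous_toFun q)) _
  let φ : P ⟶ fibProd f g :=
    { toFun := c
      continuous_toFun := hc
      proj_toFun := Hom.proj_toFun p
      map_act k z e := by
        apply Subtype.ext
        exact Prod.ext (Hom.map_act p _ _ _) (Hom.map_act q _ _ _) }
  have hbij : Function.Bijective c := by
    constructor
    · intro z z' h
      exact hinj z z' (congrArg (fun t => t.1.1) h) (congrArg (fun t => t.1.2) h)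
    · rintro ⟨⟨a, b⟩, h⟩
      obtain ⟨z, rfl, rfl⟩ := hsurj a b h
      exact ⟨z, rfl⟩
  let e : P ≃ₜ fibProd f g := (Equiv.ofBijective c hbij).toHomeomorphOfContinuousOpen hc
    (Hom.isLocalHomeomorph φ).isOpenMap
  have he : ∀ y, c (e.symm y) = y := fun y => e.apply_symm_apply y
  have he1 : ∀ y, Hom.toFun p (e.symm y) = y.1.1 := fun y => congrArg (fun t => t.1.1) (he y)
  have he2 : ∀ y, Hom.toFun q (e.symm y) = y.1.2 := fun y => congrArg (fun t => t.1.2) (he y)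
  let mk : ∀ s : PullbackCone f g, s.pt → fibProd f g := fun s z =>
    ⟨(Hom.toFun s.fst z, Hom.toFun s.snd z),
      congrArg (fun m : s.pt ⟶ C => Hom.toFun m z) s.condition⟩
  refine PullbackCone.IsLimit.mk w
    (fun s =>
      { toFun z := e.symm (mk s z)
        continuous_toFun := e.symm.continuous.comp (Continuous.subtype_mk
          (.prodMk (Hom.continuous_toFun s.fst) (Hom.continuous_toFun s.snd)) _)
        proj_toFun z := by
          exact (Hom.proj_toFun p _).symm.trans
            ((congrArg A.proj (he1 _)).trans (Hom.proj_toFun s.fst z))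
        map_act k z h := by
          apply hinj
          · refine (he1 _).trans ((Hom.map_act s.fst _ _ _).trans
              (Eq.trans ?_ (Hom.map_act p _ _ _).symm))
            exact act_congr _ rfl (he1 (mk s z)).symm _ _
          · refine (he2 _).trans ((Hom.map_act s.snd _ _ _).trans
              (Eq.trans ?_ (Hom.map_act q _ _ _).symm))
            exact act_congr _ rfl (he2 (mk s z)).symm _ _ }) ?_ ?_ ?_
  · intro s
    apply hom_ext
    intro z
    exact he1 _
  · intro s
    apply hom_ext
    intro z
    exact he2 _
  · intro s m h1 h2
    apply hom_ext
    intro z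
    apply hinj
    · exact (congrArg (fun m : s.pt ⟶ A => Hom.toFun m z) h1).trans (he1 (mk s z)).symm
    · exact (congrArg (fun m : s.pt ⟶ B => Hom.toFun m z) h2).trans (he2 (mk s z)).symm

lemma isPullback_fibProd {A B C : Sh X} (f : A ⟶ C) (g : B ⟶ C) :
    IsPullback (fibProdFst f g) (fibProdSnd f g) f g :=
  isPullback_of_bijective (fibProd_w f g)
    (fun _ _ h h' => Subtype.ext (Prod.ext h h')) (fun a b h => ⟨⟨(a, b), h⟩, rfl, rfl⟩)

instance : HasTerminal (Sh X) :=
  (isTerminalOfBijective (terminal X) Function.bijective_id).hasTerminal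

instance : HasPullbacks (Sh X) :=
  have : ∀ {A B C : Sh X} {f : A ⟶ C} {g : B ⟶ C}, HasLimit (cospan f g) :=
    fun {_ _ _ f g} => (isPullback_fibProd f g).hasPullback
  hasPullbacks_of_hasLimit_cospan _

/-- Inverse image functors are left exact. -/
instance preservesFiniteLimits_inverseImage (Φ : ContFunctor X Y) :
    PreservesFiniteLimits (inverseImage Φ) := by
  have h1 : PreservesLimit (Functor.empty.{0} (Sh Y)) (inverseImage Φ) := by
    refine preservesLimit_of_preserves_limit_cone
      (isTerminalOfBijective (terminal Y) Function.bijective_id) ?_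
    refine (isLimitMapConeEmptyConeEquiv _ _).symm (isTerminalOfBijective _ ⟨?_, ?_⟩)
    · rintro ⟨⟨x, y⟩, h⟩ ⟨⟨x', y'⟩, h'⟩ e
      have e : x = x' := e
      have h : Φ.obj x = y := h
      have h' : Φ.obj x' = y' := h'
      subst e h h'
      rfl
    · intro x
      exact ⟨⟨(x, Φ.obj x), rfl⟩, rfl⟩
  have h2 : PreservesLimitsOfShape (Discrete PEmpty.{1}) (inverseImage Φ) :=
    preservesLimitsOfShape_pempty_of_preservesTerminal _
  have h3 : PreservesLimitsOfShape WalkingCospan (inverseImage Φ) := by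
    have key : ∀ {A B C : Sh Y} (f : A ⟶ C) (g : B ⟶ C),
        PreservesLimit (cospan f g) (inverseImage Φ) := by
      intro A B C f g
      refine preservesLimit_of_preserves_limit_cone (isPullback_fibProd f g).isLimit
        ((isLimitMapConePullbackConeEquiv _ (fibProd_w f g)).symm
          (isPullback_of_bijective (by rw [← Functor.map_comp, ← Functor.map_comp, fibProd_w])
            ?_ ?_).isLimit)
      · rintro ⟨⟨x, z⟩, h⟩ ⟨⟨x', z'⟩, h'⟩ e e'
        apply Subtype.ext
        refine Prod.ext (congrArg (fun t => t.1.1) e) (Subtype.ext (Prod.ext ?_ ?_))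
        · exact congrArg (fun t => t.1.2) e
        · exact congrArg (fun t => t.1.2) e'
      · rintro ⟨⟨x, a⟩, h⟩ ⟨⟨x', b⟩, h'⟩ e
        have e1 : x = x' := congrArg (fun t => t.1.1) e
        subst e1
        exact ⟨⟨(x, ⟨(a, b), congrArg (fun t => t.1.2) e⟩), h⟩, rfl, rfl⟩
    exact ⟨fun {K} => preservesLimit_of_iso_diagram _ (diagramIsoCospan K).symm⟩
  exact preservesFiniteLimits_of_preservesTerminal_and_pullbacks _

end LeftExact
section RightAdjoint

lemma map_nhds (A B : Sh X) (f : A ⟶ B) (a : A) :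
    (𝓝 a).map (Hom.toFun f) = 𝓝 (Hom.toFun f a) :=
  (Hom.isLocalHomeomorph f).map_nhds_eq a

/-- Continuity of a map out of a sheaf can be checked on a jointly surjective family. -/
lemma continuous_of_cover {B : Sh X} {S : Type*} [TopologicalSpace S] {k : B → S}
    (h : ∀ b : B, ∃ (A : Sh X) (f : A ⟶ B) (a : A), Hom.toFun f a = b ∧
      Continuous (fun a => k (Hom.toFun f a))) : Continuous k := by
  rw [continuous_iff_continuousAt]
  intro b
  obtain ⟨A, f, a, rfl, hc⟩ := h b
  rw [ContinuousAt, ← map_nhds A B f a, Filter.tendsto_map'_iff]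
  exact hc.continuousAt

/-- The subsheaf on an open invariant subset. -/
def sub (W : Sh X) (T : Set W) (hT : IsOpen T)
    (hact : ∀ g w e, w ∈ T → W.act g w e ∈ T) : Sh X where
  carrier := T
  str :=
    { proj := fun w => W.proj w.1
      isLocalHomeomorph_proj :=
        W.str.isLocalHomeomorph_proj.comp hT.isOpenEmbedding_subtypeVal.isLocalHomeomorph
      act := fun g w e => ⟨W.act g w.1 e, hact g w.1 e w.2⟩
      continuous_act :=
        Continuous.subtype_mk (W.continuous_act' (by fun_prop) (by fun_prop) _) _
      proj_act := fun g w e => W.str.proj_act _ _ _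
      act_one := fun w => Subtype.ext (W.str.act_one _)
      act_comp := fun g h w e e' => Subtype.ext (W.str.act_comp _ _ _ _ _) }

def subι (W : Sh X) (T : Set W) (hT : IsOpen T)
    (hact : ∀ g w e, w ∈ T → W.act g w e ∈ T) : sub W T hT hact ⟶ W where
  toFun w := w.1
  continuous_toFun := continuous_subtype_val
  proj_toFun _ := rfl
  map_act _ _ _ := rfl

/-- Transport of a sheaf along a bijection of the underlying set. -/
def transport (W : Sh X) {S : Type u} (j : S ≃ W) : Sh X :=
  letI : TopologicalSpace S := TopologicalSpace.induced j inferInstance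
  have hj : Topology.IsInducing j := ⟨rfl⟩
  have hjc : Continuous j := hj.continuous
  { carrier := S
    str :=
      { proj := fun w => W.proj (j w)
        isLocalHomeomorph_proj := W.str.isLocalHomeomorph_proj.comp
          (j.toHomeomorphOfIsInducing hj).isLocalHomeomorph
        act := fun g w e => j.symm (W.act g (j w) e)
        continuous_act := by
          rw [hj.continuous_iff]
          simp only [Function.comp_def, Equiv.apply_symm_apply]
          exact W.continuous_act' (by fun_prop) (by fun_prop) _
        proj_act := fun g w e => by simp
        act_one := fun w => by simp
        act_comp := fun g h w e e' => by
          apply congrArg j.symm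
          exact (act_congr _ rfl (by simp) _ _).trans (W.str.act_comp g h _ e e') } }

def transportHom (W : Sh X) {S : Type u} (j : S ≃ W) : transport W j ⟶ W where
  toFun := j
  continuous_toFun := continuous_induced_dom
  proj_toFun _ := rfl
  map_act _ _ _ := by
    exact j.apply_symm_apply _

/-- Every point of a sheaf lies in the image of a sheaf whose underlying set is a subset of a fixed
set. -/
lemma exists_small (W : Sh X) (w : W) :
    ∃ (S : Set (List (X.Arr × X.Obj))) (_ : TopologicalSpace S) (str : SheafStr X S)
      (f : Sh.mk S str ⟶ W) (b : S), Hom.toFun f b = w := by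
  classical
  choose O hO hmem hinj using W.str.isLocalHomeomorph_proj.isLocallyInjective
  let Q : W → X.Arr × X.Obj → W → Prop := fun v gy v' =>
    ∃ e : X.src gy.1 = W.proj v, v' ∈ O (W.act gy.1 v e) ∧ W.proj v' = gy.2
  let step : W → X.Arr × X.Obj → W := fun v gy =>
    if h : ∃ v', Q v gy v' then h.choose else v
  have hstep : ∀ v gy v', Q v gy v' → step v gy = v' := by
    intro v gy v' h
    have h' : ∃ v', Q v gy v' := ⟨v', h⟩
    have e1 : step v gy = h'.choose := dif_pos h'
    obtain ⟨e, h1, h2⟩ := h'.choose_spec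
    obtain ⟨e, h3, h4⟩ := h
    rw [e1]
    exact hinj _ h1 h3 (h2.trans h4.symm)
  let ev : List (X.Arr × X.Obj) → W := fun l => l.foldl step w
  let T : Set W := Set.range ev
  have hTs : ∀ v ∈ T, ∀ gy, step v gy ∈ T := by
    rintro _ ⟨l, rfl⟩ gy
    exact ⟨l ++ [gy], by simp [ev]⟩
  have hT : IsOpen T := by
    rw [isOpen_iff_forall_mem_open]
    intro v hv
    refine ⟨O v, ?_, hO v, hmem v⟩
    intro v' hv'
    have := hTs v hv (X.one (W.proj v), W.proj v')
    rwa [hstep v _ v' ⟨X.src_one _, by simpa using hv', rfl⟩] at this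
  have hact : ∀ g v e, v ∈ T → W.act g v e ∈ T := by
    intro g v e hv
    have := hTs v hv (g, X.tgt g)
    rwa [hstep v _ (W.act g v e) ⟨e, hmem _, by simp⟩] at this
  let A := sub W T hT hact
  have hs : ∀ a : A, ∃ l, ev l = a.1 := fun a => a.2
  choose c hc using hs
  have hcinj : Function.Injective c := by
    intro a a' h
    apply Subtype.ext
    rw [← hc, ← hc, h]
  let j := (Equiv.ofInjective c hcinj).symm
  refine ⟨Set.range c, _, (transport A j).str, transportHom A j ≫ subι W T hT hact,
    j.symm ⟨w, ⟨[], rfl⟩⟩, ?_⟩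
  exact congrArg Subtype.val (j.apply_symm_apply _)

/-- The sheaf obtained by gluing a small family of sheaves along an open invariant equivalence
relation on its disjoint union. -/
noncomputable def glue {ι : Type u} (W : ι → Sh X) (r : Setoid (Σ i, W i))
    (hproj : ∀ p q, r p q → (W p.1).proj p.2 = (W q.1).proj q.2)
    (hact : ∀ p q g e e', r p q → r ⟨p.1, (W p.1).act g p.2 e⟩ ⟨q.1, (W q.1).act g q.2 e'⟩)
    (hopen : ∀ i (U : Set (W i)), IsOpen U → IsOpen {q | ∃ w ∈ U, r ⟨i, w⟩ q}) : Sh X :=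
  let pr : Quotient r → X.Obj := Quotient.lift (fun p => (W p.1).proj p.2) hproj
  let ac : (g : X.Arr) → (q : Quotient r) → X.src g = pr q → Quotient r := fun g q e =>
    ⟦⟨q.out.1, (W q.out.1).act g q.out.2 (e.trans (congrArg pr q.out_eq.symm))⟩⟧
  have hac : ∀ g i w e, ac g ⟦⟨i, w⟩⟧ e = ⟦⟨i, (W i).act g w e⟩⟧ := fun g i w e =>
    Quotient.sound (hact _ _ _ _ _ (Quotient.mk_out (s := r) ⟨i, w⟩))
  let c : ∀ i, W i → Quotient r := fun i w => ⟦⟨i, w⟩⟧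
  have hc : ∀ i, Continuous (c i) := fun i => continuous_quot_mk.comp continuous_sigmaMk
  have hpr : Continuous pr := by
    refine Continuous.quotient_lift ?_ _
    exact continuous_sigma fun i => (W i).continuous_proj
  have hco : ∀ i, IsOpenMap (c i) := by
    intro i U hU
    refine isOpen_coinduced.2 ?_
    convert hopen i U hU using 1
    ext q
    constructor
    · rintro ⟨w, hw, h⟩
      exact ⟨w, hw, Quotient.exact h⟩
    · rintro ⟨w, hw, h⟩
      exact ⟨w, hw, Quotient.sound h⟩
  have hprL : IsLocalHomeomorph pr := by
    refine isLocalHomeomorph_of hpr ?_ ?_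
    · rw [isOpenMap_iff_nhds_le]
      intro q
      induction q using Quotient.inductionOn with
      | _ p =>
      obtain ⟨i, w⟩ := p
      refine le_trans ((W i).str.isLocalHomeomorph_proj.map_nhds_eq w).ge ?_
      have : Filter.map (c i) (𝓝 w) ≤ 𝓝 (c i w) := (hc i).continuousAt
      exact (Filter.map_mono (m := pr) this)
    · intro q
      induction q using Quotient.inductionOn with
      | _ p =>
      obtain ⟨i, w⟩ := p
      obtain ⟨U, hU, hw, hinj⟩ := (W i).str.isLocalHomeomorph_proj.isLocallyInjective w
      refine ⟨c i '' U, hco i U hU, ⟨w, hw, rfl⟩, ?_⟩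
      rintro _ ⟨w1, h1, rfl⟩ _ ⟨w2, h2, rfl⟩ h
      exact congrArg (c i) (hinj h1 h2 h)
  { carrier := Quotient r
    str :=
      { proj := pr
        isLocalHomeomorph_proj := hprL
        act := ac
        continuous_act := by
          rw [continuous_iff_continuousAt]
          rintro ⟨⟨g, q⟩, e⟩
          induction q using Quotient.inductionOn with
          | _ p =>
          obtain ⟨i, w⟩ := p
          let m : {p : X.Arr × W i // X.src p.1 = (W i).proj p.2} →
            {p : X.Arr × Quotient r // X.src p.1 = pr p.2} := fun p => ⟨(p.1.1, c i p.1.2), p.2⟩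
          have hmc : Continuous m := Continuous.subtype_mk
            (.prodMk (by fun_prop) ((hc i).comp (by fun_prop))) _
          have hm : IsLocalHomeomorph m := IsLocalHomeomorph.of_comp
            (g := fun p : {p : X.Arr × Quotient r // X.src p.1 = pr p.2} => p.1.1)
            (isLocalHomeomorph_pullback X.continuous_src (W i).str.isLocalHomeomorph_proj)
            (isLocalHomeomorph_pullback X.continuous_src hprL) hmc
          have := hm.map_nhds_eq ⟨(g, w), e⟩
          change Filter.Tendsto _ (𝓝 (m ⟨(g, w), e⟩)) _
          rw [← this, Filter.tendsto_map'_iff]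
          refine ContinuousAt.congr (f := fun p => c i ((W i).act p.1.1 p.1.2 p.2)) ?_ ?_
          · exact ((hc i).comp (W i).str.continuous_act).continuousAt
          · exact Filter.Eventually.of_forall fun p => (hac _ _ _ _).symm
        proj_act := by
          intro g q e
          induction q using Quotient.inductionOn with
          | _ p =>
          exact (congrArg pr (hac g p.1 p.2 e)).trans ((W p.1).str.proj_act _ _ _)
        act_one := by
          intro q
          induction q using Quotient.inductionOn with
          | _ p => exact (hac _ _ _ _).trans (congrArg (c p.1) ((W p.1).str.act_one _))
        act_comp := by
          intro g h q e e'
          induction q using Quotient.inductionOn with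
          | _ p =>
          have h1 := hac g p.1 p.2 e
          simp only [h1]
          exact (hac _ _ _ _).trans ((congrArg (c p.1) ((W p.1).str.act_comp _ _ _ _ _)).trans
            (hac _ _ _ _).symm) } }

variable (Φ : ContFunctor X Y) (V : Sh X)

/-- A small sheaf `W` on `Y` together with a morphism `Sh(Φ)^* W ⟶ V`. -/
structure DirIdx : Type u where
  S : Set (List (Y.Arr × Y.Obj))
  [top : TopologicalSpace S]
  str : SheafStr Y S
  map : (inverseImage Φ).obj ⟨S, str⟩ ⟶ V

attribute [instance] DirIdx.top

variable {Φ V}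

abbrev DirIdx.sheaf (i : DirIdx Φ V) : Sh Y := ⟨i.S, i.str⟩

/-- Two points are identified if they have a common preimage in a sheaf over both. -/
def dirRel (p q : Σ i : DirIdx Φ V, i.sheaf) : Prop :=
  ∃ (P : Sh Y) (f : P ⟶ p.1.sheaf) (g : P ⟶ q.1.sheaf) (z : P),
    (inverseImage Φ).map f ≫ p.1.map = (inverseImage Φ).map g ≫ q.1.map ∧
    Hom.toFun f z = p.2 ∧ Hom.toFun g z = q.2

lemma dirRel_trans {p q r : Σ i : DirIdx Φ V, i.sheaf} (h : dirRel p q) (h' : dirRel q r) :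
    dirRel p r := by
  obtain ⟨P, f, g, z, e, e1, e2⟩ := h
  obtain ⟨P', f', g', z', e', e1', e2'⟩ := h'
  refine ⟨fibProd g f', fibProdFst g f' ≫ f, fibProdSnd g f' ≫ g', ⟨(z, z'), e2.trans e1'.symm⟩,
    ?_, e1, e2'⟩
  rw [Functor.map_comp, Functor.map_comp, Category.assoc, Category.assoc, e, ← e',
    ← Category.assoc, ← Category.assoc, ← Functor.map_comp, ← Functor.map_comp, fibProd_w]

variable (Φ V) in
def dirSetoid : Setoid (Σ i : DirIdx Φ V, i.sheaf) where
  r := dirRel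
  iseqv :=
    ⟨fun p => ⟨p.1.sheaf, 𝟙 _, 𝟙 _, p.2, rfl, rfl, rfl⟩,
     fun ⟨P, f, g, z, e, e1, e2⟩ => ⟨P, g, f, z, e.symm, e2, e1⟩,
     dirRel_trans⟩

variable (Φ V) in
/-- The direct image of `V` along `Φ`. -/
noncomputable def dirObj : Sh Y :=
  glue (fun i : DirIdx Φ V => i.sheaf) (dirSetoid Φ V)
    (by
      rintro p q ⟨P, f, g, z, -, e1, e2⟩
      rw [← e1, ← e2, Hom.proj_toFun f, Hom.proj_toFun g])
    (by
      rintro p q k e e' ⟨P, f, g, z, h, e1, e2⟩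
      have hz : Y.src k = P.proj z := by rw [e, ← e1, Hom.proj_toFun f]
      exact ⟨P, f, g, P.act k z hz, h, (Hom.map_act f _ _ _).trans (act_congr _ rfl e1 _ _),
        (Hom.map_act g _ _ _).trans (act_congr _ rfl e2 _ _)⟩)
    (by
      intro i U hU
      rw [isOpen_iff_forall_mem_open]
      rintro ⟨j, w'⟩ ⟨w, hw, ⟨P, f, g, z, h, e1, e2⟩⟩
      refine ⟨Sigma.mk j '' (Hom.toFun g '' (Hom.toFun f ⁻¹' U)), ?_, ?_, ?_⟩
      · rintro _ ⟨_, ⟨z', hz', rfl⟩, rfl⟩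
        exact ⟨_, hz', P, f, g, z', h, rfl, rfl⟩
      · exact isOpenMap_sigmaMk _ ((Hom.isLocalHomeomorph g).isOpenMap _
          (hU.preimage (Hom.continuous_toFun f)))
      · refine ⟨w', ⟨z, ?_, e2⟩, rfl⟩
        change Hom.toFun f z ∈ U
        rw [e1]
        exact hw)

/-- The canonical map from a member of the family to the direct image. -/
noncomputable def dirι (i : DirIdx Φ V) : i.sheaf ⟶ dirObj Φ V where
  toFun w := Quotient.mk (dirSetoid Φ V) ⟨i, w⟩
  continuous_toFun := continuous_quot_mk.comp continuous_sigmaMk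
  proj_toFun _ := rfl
  map_act g w e :=
    (Quotient.sound (by
      obtain ⟨P, f, k, z, h, e1, e2⟩ := Quotient.mk_out (s := dirSetoid Φ V) ⟨i, w⟩
      have hz : Y.src g = P.proj z :=
        e.trans ((congrArg i.sheaf.proj e2).symm.trans (Hom.proj_toFun k z))
      exact ⟨P, f, k, P.act g z hz, h, (Hom.map_act f _ _ _).trans (act_congr _ rfl e1 _ _),
        (Hom.map_act k _ _ _).trans (act_congr _ rfl e2 _ _)⟩)).symm

lemma dirι_surj (q : dirObj Φ V) : ∃ (i : DirIdx Φ V) (w : i.sheaf), Hom.toFun (dirι i) w = q := by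
  obtain ⟨⟨i, w⟩, h⟩ := Quotient.exists_rep (s := dirSetoid Φ V) q
  exact ⟨i, w, h⟩

lemma dirι_eq_iff {i j : DirIdx Φ V} {w : i.sheaf} {w' : j.sheaf} :
    Hom.toFun (dirι i) w = Hom.toFun (dirι j) w' ↔ dirRel ⟨i, w⟩ ⟨j, w'⟩ :=
  ⟨fun h => Quotient.exact (s := dirSetoid Φ V) h, fun h => Quotient.sound (s := dirSetoid Φ V) h⟩

lemma counit_wd {i j : DirIdx Φ V} {w : i.sheaf} {w' : j.sheaf}
    (h : Hom.toFun (dirι i) w = Hom.toFun (dirι j) w') (x : X.Obj) (e : Φ.obj x = i.sheaf.proj w)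
    (e' : Φ.obj x = j.sheaf.proj w') :
    Hom.toFun i.map ⟨(x, w), e⟩ = Hom.toFun j.map ⟨(x, w'), e'⟩ := by
  have h0 : ∃ (P : Sh Y) (f : P ⟶ i.sheaf) (g : P ⟶ j.sheaf) (z : P),
      (inverseImage Φ).map f ≫ i.map = (inverseImage Φ).map g ≫ j.map ∧
      Hom.toFun f z = w ∧ Hom.toFun g z = w' := dirι_eq_iff.1 h
  obtain ⟨P, f, g, z, hP, rfl, rfl⟩ := h0
  have hz : Φ.obj x = P.proj z := e.trans (Hom.proj_toFun f z)
  exact congrArg (fun m : (inverseImage Φ).obj P ⟶ V => Hom.toFun m ⟨(x, z), hz⟩) hP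

variable (Φ V) in
/-- The counit `Sh(Φ)^* Sh(Φ)_* V ⟶ V`. -/
noncomputable def dirCounit : (inverseImage Φ).obj (dirObj Φ V) ⟶ V :=
  let idx : dirObj Φ V → DirIdx Φ V := fun q => (dirι_surj q).choose
  let pt : ∀ q : dirObj Φ V, (idx q).sheaf := fun q => (dirι_surj q).choose_spec.choose
  have hpt : ∀ q, Hom.toFun (dirι (idx q)) (pt q) = q := fun q =>
    (dirι_surj q).choose_spec.choose_spec
  have hpr : ∀ q, (idx q).sheaf.proj (pt q) = (dirObj Φ V).proj q := fun q =>
    (Hom.proj_toFun (dirι (idx q)) (pt q)).symm.trans (congrArg _ (hpt q))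
  let F : (inverseImage Φ).obj (dirObj Φ V) → V := fun p =>
    Hom.toFun (idx p.1.2).map ⟨(p.1.1, pt p.1.2), p.2.trans (hpr _).symm⟩
  have hF : ∀ (i : DirIdx Φ V) (p : (inverseImage Φ).obj i.sheaf),
      F (Hom.toFun ((inverseImage Φ).map (dirι i)) p) = Hom.toFun i.map p := fun i p =>
    counit_wd (hpt _) _ _ p.2
  have hsurj : ∀ p : (inverseImage Φ).obj (dirObj Φ V), ∃ (i : DirIdx Φ V)
      (p' : (inverseImage Φ).obj i.sheaf), Hom.toFun ((inverseImage Φ).map (dirι i)) p' = p := by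
    rintro ⟨⟨x, q⟩, e⟩
    obtain ⟨i, w, rfl⟩ := dirι_surj q
    exact ⟨i, ⟨(x, w), e⟩, rfl⟩
  { toFun := F
    continuous_toFun := by
      refine continuous_of_cover fun p => ?_
      obtain ⟨i, p', rfl⟩ := hsurj p
      refine ⟨_, (inverseImage Φ).map (dirι i), p', rfl, ?_⟩
      simp only [hF]
      exact Hom.continuous_toFun i.map
    proj_toFun := by
      intro p
      obtain ⟨i, p', rfl⟩ := hsurj p
      rw [hF, Hom.proj_toFun, Hom.proj_toFun]
    map_act := by
      intro g p e
      obtain ⟨i, p', rfl⟩ := hsurj p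
      have e' : X.src g = ((inverseImage Φ).obj i.sheaf).proj p' := e
      refine (congrArg F (Hom.map_act ((inverseImage Φ).map (dirι i)) g p' e').symm).trans ?_
      rw [hF, Hom.map_act]
      exact act_congr _ rfl (hF _ _).symm _ _ }

lemma dirCounit_ι (i : DirIdx Φ V) :
    (inverseImage Φ).map (dirι i) ≫ dirCounit Φ V = i.map := by
  apply hom_ext
  intro p
  have h := (dirι_surj (Hom.toFun (dirι i) p.1.2)).choose_spec.choose_spec
  exact counit_wd h _ _ p.2

lemma dir_hom_unique {W : Sh Y} (h h' : W ⟶ dirObj Φ V)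
    (e : (inverseImage Φ).map h ≫ dirCounit Φ V = (inverseImage Φ).map h' ≫ dirCounit Φ V) :
    h = h' := by
  apply hom_ext
  intro w
  obtain ⟨i, a, ha⟩ := dirι_surj (Hom.toFun h w)
  obtain ⟨j, b, hb⟩ := dirι_surj (Hom.toFun h' w)
  rw [← ha, ← hb, dirι_eq_iff]
  refine ⟨fibProd (fibProdSnd (dirι i) h) (fibProdSnd (dirι j) h'),
    fibProdFst _ _ ≫ fibProdFst _ _, fibProdSnd _ _ ≫ fibProdFst _ _,
    ⟨(⟨(a, w), ha⟩, ⟨(b, w), hb⟩), rfl⟩, ?_, rfl, rfl⟩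
  have e1 : ∀ {i : DirIdx Φ V} {P : Sh Y} (k : P ⟶ i.sheaf),
      (inverseImage Φ).map k ≫ i.map = (inverseImage Φ).map (k ≫ dirι i) ≫ dirCounit Φ V := by
    intro i P k
    rw [Functor.map_comp, Category.assoc, dirCounit_ι]
  refine (e1 _).trans (Eq.trans ?_ (e1 _).symm)
  rw [Category.assoc, Category.assoc, fibProd_w, fibProd_w, ← Category.assoc, fibProd_w,
    Functor.map_comp, Category.assoc, e, ← Category.assoc, ← Functor.map_comp, Category.assoc]

lemma dir_hom_exists {W : Sh Y} (α : (inverseImage Φ).obj W ⟶ V) :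
    ∃ h : W ⟶ dirObj Φ V, (inverseImage Φ).map h ≫ dirCounit Φ V = α := by
  have key : ∀ w : W, ∃ (i : DirIdx Φ V) (f : i.sheaf ⟶ W) (b : i.sheaf),
      (inverseImage Φ).map f ≫ α = i.map ∧ Hom.toFun f b = w := by
    intro w
    obtain ⟨S, t, str, f, b, h⟩ := exists_small W w
    exact ⟨⟨S, str, (inverseImage Φ).map f ≫ α⟩, f, b, rfl, h⟩
  choose idx f b hf hb using key
  let H : W → dirObj Φ V := fun w => Hom.toFun (dirι (idx w)) (b w)
  have hH : ∀ (i : DirIdx Φ V) (k : i.sheaf ⟶ W) (hk : (inverseImage Φ).map k ≫ α = i.map)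
      (c : i.sheaf), H (Hom.toFun k c) = Hom.toFun (dirι i) c := by
    intro i k hk c
    refine dirι_eq_iff.2 ⟨fibProd (f (Hom.toFun k c)) k, fibProdFst _ _, fibProdSnd _ _,
      ⟨(b _, c), hb _⟩, ?_, rfl, rfl⟩
    rw [← hf, ← hk, ← Category.assoc, ← Functor.map_comp, fibProd_w, Functor.map_comp,
      Category.assoc]
  let h : W ⟶ dirObj Φ V :=
    { toFun := H
      continuous_toFun := by
        refine continuous_of_cover fun w => ⟨_, f w, b w, hb w, ?_⟩
        simp only [hH _ _ (hf w)]
        exact Hom.continuous_toFun (dirι (idx w))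
      proj_toFun := by
        intro w
        exact (Hom.proj_toFun (dirι (idx w)) _).trans ((Hom.proj_toFun (f w) _).symm.trans
          (congrArg _ (hb w)))
      map_act := by
        intro g w e
        have e' : Y.src g = (idx w).sheaf.proj (b w) := by
          rw [e, ← Hom.proj_toFun (f w), hb]
        have h1 : W.act g w e = Hom.toFun (f w) ((idx w).sheaf.act g (b w) e') := by
          rw [Hom.map_act]
          exact act_congr _ rfl (hb w).symm _ _
        rw [h1, hH _ _ (hf w), Hom.map_act] }
  refine ⟨h, ?_⟩
  apply hom_ext
  rintro ⟨⟨x, w⟩, e⟩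
  have e' : Φ.obj x = (idx w).sheaf.proj (b w) := by
    refine Eq.trans e ?_
    rw [← Hom.proj_toFun (f w), hb]
  have e1 := congrArg (fun m : (inverseImage Φ).obj (idx w).sheaf ⟶ V =>
    Hom.toFun m ⟨(x, b w), e'⟩) (dirCounit_ι (idx w))
  have e2 := congrArg (fun m : (inverseImage Φ).obj (idx w).sheaf ⟶ V =>
    Hom.toFun m ⟨(x, b w), e'⟩) (hf w)
  refine Eq.trans (e1.trans e2.symm) ?_
  change Hom.toFun α ⟨(x, Hom.toFun (f w) (b w)), _⟩ = _
  simp only [hb]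

/-- Inverse image functors have right adjoints. -/
instance isLeftAdjoint_inverseImage (Φ : ContFunctor X Y) : (inverseImage Φ).IsLeftAdjoint := by
  have : ∀ V, HasTerminal (CostructuredArrow (inverseImage Φ) V) := by
    intro V
    refine IsTerminal.hasTerminal (X := CostructuredArrow.mk (dirCounit Φ V))
      (IsTerminal.ofUniqueHom (fun A => CostructuredArrow.homMk (dir_hom_exists A.hom).choose
        (dir_hom_exists A.hom).choose_spec) ?_)
    intro A m
    apply CostructuredArrow.hom_ext
    apply dir_hom_unique
    exact (CostructuredArrow.w m).trans (dir_hom_exists A.hom).choose_spec.symm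
  exact isLeftAdjoint_of_costructuredArrowTerminals _

end RightAdjoint

end Sh
end TopGrpd

/-- A geometric morphism `f : E → F`: an adjunction `f^* ⊣ f_*` with left exact inverse image part
`f^* : F ⥤ E`. -/
structure GeomMorphism (E F : Type (u + 1)) [Category.{u} E] [Category.{u} F] : Type (u + 1) where
  inv : F ⥤ E
  dir : E ⥤ F
  adj : inv ⊣ dir
  leftExact : PreservesFiniteLimits inv

namespace GeomMorphism

variable {E F G H T : Type (u + 1)} [Category.{u} E] [Category.{u} F] [Category.{u} G]
  [Category.{u} H] [Category.{u} T]

/-- The hom-category `Topos(E, F)`: its morphisms `f ⟶ g` are the natural transformations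
`f^* ⟶ g^*`. -/
instance : Category.{u + 1} (GeomMorphism E F) where
  Hom f g := f.inv ⟶ g.inv
  id f := 𝟙 f.inv
  comp α β := @CategoryStruct.comp (F ⥤ E) _ _ _ _ α β
  id_comp α := Category.id_comp (X := (_ : F ⥤ E)) α
  comp_id α := Category.comp_id (X := (_ : F ⥤ E)) α
  assoc α β γ := Category.assoc (W := (_ : F ⥤ E)) α β γ

/-- An isomorphism of inverse images is an isomorphism of geometric morphisms. -/
def isoMk {f g : GeomMorphism E F} (e : f.inv ≅ g.inv) : f ≅ g where
  hom := e.hom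
  inv := e.inv
  hom_inv_id := e.hom_inv_id
  inv_hom_id := e.inv_hom_id

/-- The composite `g ∘ f` of geometric morphisms. -/
def comp (f : GeomMorphism E F) (g : GeomMorphism F G) : GeomMorphism E G where
  inv := g.inv ⋙ f.inv
  dir := f.dir ⋙ g.dir
  adj := g.adj.comp f.adj
  leftExact :=
    have := f.leftExact
    have := g.leftExact
    comp_preservesFiniteLimits _ _

/-- Composition `f ↦ g ∘ f` with a fixed geometric morphism, `Topos(T, F) ⥤ Topos(T, G)`. -/
def postcomp (T : Type (u + 1)) [Category.{u} T] (g : GeomMorphism F G) :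
    GeomMorphism T F ⥤ GeomMorphism T G where
  obj f := f.comp g
  map α := Functor.whiskerLeft g.inv α

/-- For a square of geometric morphisms
```
  E --p--> F
  |        |
  q        f
  v        v
  G --g--> H
```
filled by an isomorphism `θ : f ∘ p ≅ g ∘ q`, the functor from `Topos(T, E)` to the category of
triples `(a : T → F, b : T → G, f ∘ a ≅ g ∘ b)` which sends `h` to `(p ∘ h, q ∘ h, θ ∘ h)`. -/
def toConeFunctor (T : Type (u + 1)) [Category.{u} T] {p : GeomMorphism E F} {q : GeomMorphism E G}
    {f : GeomMorphism F H} {g : GeomMorphism G H} (θ : p.comp f ≅ q.comp g) :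
    GeomMorphism T E ⥤ CategoricalPullback (postcomp T f) (postcomp T g) where
  obj h :=
    { fst := h.comp p
      snd := h.comp q
      iso :=
        { hom := Functor.whiskerRight θ.hom h.inv
          inv := Functor.whiskerRight θ.inv h.inv
          hom_inv_id := by
            apply NatTrans.ext
            funext A
            exact (h.inv.map_comp _ _).symm.trans
              ((congrArg (fun m => h.inv.map (NatTrans.app m A)) θ.hom_inv_id).trans
                (h.inv.map_id _))
          inv_hom_id := by
            apply NatTrans.ext
            funext A
            exact (h.inv.map_comp _ _).symm.trans
              ((congrArg (fun m => h.inv.map (NatTrans.app m A)) θ.inv_hom_id).trans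
                (h.inv.map_id _)) } }
  map {h k} α :=
    { fst := Functor.whiskerLeft p.inv α
      snd := Functor.whiskerLeft q.inv α
      w := by
        apply NatTrans.ext
        funext A
        exact (NatTrans.naturality (F := h.inv) (G := k.inv) α (NatTrans.app θ.hom A)).symm }

end GeomMorphism

/-- Grothendieck topoi: the categories equivalent to the category of sheaves on a small site. -/
def IsGrothendieckTopos (E : Type (u + 1)) [Category.{u} E] : Prop :=
  ∃ (C : Type u) (_ : SmallCategory C) (J : GrothendieckTopology C),
    Nonempty (E ≌ Sheaf J (Type u))

/-- A topos has enough points if the inverse image functors of its points `Set → E` are jointly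
conservative. -/
def ToposHasEnoughPoints (E : Type (u + 1)) [Category.{u} E] : Prop :=
  ∀ ⦃A B : E⦄ (f : A ⟶ B), (∀ p : GeomMorphism (Type u) E, IsIso (p.inv.map f)) → IsIso f

/-- The square of geometric morphisms filled by `θ` is a bi-pullback in the bi-category of
Grothendieck topoi with enough points, geometric morphisms and natural transformations: for every
topos `T` with enough points, geometric morphisms `T → E` are the same as pairs of geometric
morphisms `T → F`, `T → G` with an isomorphism between their composites to `H`. -/
def IsBipullbackWEP {E F G H : Type (u + 1)} [Category.{u} E] [Category.{u} F] [Category.{u} G]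
    [Category.{u} H] {p : GeomMorphism E F} {q : GeomMorphism E G}
    {f : GeomMorphism F H} {g : GeomMorphism G H} (θ : p.comp f ≅ q.comp g) : Prop :=
  ∀ (T : Type (u + 1)) [Category.{u} T], IsGrothendieckTopos T → ToposHasEnoughPoints T →
    (GeomMorphism.toConeFunctor T θ).IsEquivalence

namespace TopGrpd

/-- The geometric morphism `Sh(Φ) : Sh(X) → Sh(Y)` of a continuous functor `Φ : X → Y`. -/
noncomputable def shGeom {X Y : TopGrpd.{u}} (Φ : ContFunctor X Y) :
    GeomMorphism (Sh X) (Sh Y) where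
  inv := Sh.inverseImage Φ
  dir := (Sh.inverseImage Φ).rightAdjoint
  adj := Adjunction.ofIsLeftAdjoint _
  leftExact := inferInstance

/-- The action of `Sh` on hom-categories, as a functor `TopGrpd(X, Y) ⥤ Topos(Sh(X), Sh(Y))`. -/
noncomputable def shFunctor (X Y : TopGrpd.{u}) : ContFunctor X Y ⥤ GeomMorphism (Sh X) (Sh Y) where
  obj Φ := shGeom Φ
  map a := Sh.inverseImageMap a
  map_id Φ := by
    apply NatTrans.ext
    funext W
    apply Sh.hom_ext
    rintro ⟨⟨x, w⟩, h⟩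
    apply Subtype.ext
    exact Prod.ext rfl ((Sh.act_congr W (congrArg Y.one h) rfl _ (Y.src_one _)).trans
      (W.str.act_one w))
  map_comp {Φ Ψ Θ} a b := by
    apply NatTrans.ext
    funext W
    apply Sh.hom_ext
    intro p
    apply Subtype.ext
    exact Prod.ext rfl (W.str.act_comp _ _ _ _ _).symm

/-- The action of `Sh` on hom-categories, `TopGrpd(X, Y) ⥤ Topos^iso(Sh(X), Sh(Y))`, where the
target is the category of geometric morphisms and natural isomorphisms. -/
noncomputable def shIso (X Y : TopGrpd.{u}) :
    ContFunctor X Y ⥤ Core (GeomMorphism (Sh X) (Sh Y)) :=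
  Core.functorToCore (shFunctor X Y)

/-- The canonical isomorphism `Sh(Ψ) ∘ Sh(Φ) ≅ Sh(Ψ ∘ Φ)`. -/
noncomputable def shComp {X Y Z : TopGrpd.{u}} (Φ : ContFunctor X Y) (Ψ : ContFunctor Y Z) :
    (shGeom Φ).comp (shGeom Ψ) ≅ shGeom (Φ.comp Ψ) :=
  GeomMorphism.isoMk (Sh.inverseImageComp Φ Ψ)

/-- A topological space as a topological groupoid with only identity arrows. -/
def disc (S : Type u) [TopologicalSpace S] : TopGrpd.{u} where
  Obj := S
  Arr := S
  src x := x
  tgt x := x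
  one x := x
  inv x := x
  comp x _ _ := x
  src_one _ := rfl
  tgt_one _ := rfl
  src_inv _ := rfl
  tgt_inv _ := rfl
  src_comp _ _ _ := rfl
  tgt_comp _ _ e := e
  one_comp _ := rfl
  comp_one _ := rfl
  assoc _ _ _ _ _ := rfl
  comp_inv _ := rfl
  inv_comp _ := rfl
  continuous_src := continuous_id
  continuous_tgt := continuous_id
  continuous_one := continuous_id
  continuous_inv := continuous_id
  continuous_comp := by fun_prop

/-- A continuous map as a continuous functor. -/
def discMap {S T : Type u} [TopologicalSpace S] [TopologicalSpace T] (f : S → T)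
    (hf : Continuous f) : ContFunctor (disc S) (disc T) where
  obj := f
  arr := f
  src_arr _ := rfl
  tgt_arr _ := rfl
  arr_one _ := rfl
  arr_comp _ _ _ := rfl
  continuous_obj := hf
  continuous_arr := hf

/-- The identity-on-objects functor from the space of objects of `X` to `X`. The geometric morphism
`shGeom (fromObj X)` is `u_X : Sh(X₀) → Sh(X)`. -/
def fromObj (X : TopGrpd.{u}) : ContFunctor (disc X.Obj) X where
  obj x := x
  arr x := X.one x
  src_arr x := X.src_one x
  tgt_arr x := X.tgt_one x
  arr_one _ := rfl
  arr_comp x y e := by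
    have e : x = y := e
    subst e
    exact (X.comp_one (X.one x)).symm.trans (comp_congr rfl (congrArg X.one (X.tgt_one x)) _ _)
  continuous_obj := continuous_id
  continuous_arr := X.continuous_one

/-- The tautological continuous transformation `u ∘ s ⇒ u ∘ t` between functors from the space of
arrows of `X` to `X`, whose component at an arrow `g` is `g : s(g) ⟶ t(g)`. -/
def arrTrans (X : TopGrpd.{u}) :
    ContTrans ((discMap X.src X.continuous_src).comp (fromObj X))
      ((discMap X.tgt X.continuous_tgt).comp (fromObj X)) where
  app g := g
  src_app _ := rfl
  tgt_app _ := rfl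
  naturality g := (X.one_comp g).trans (X.comp_one g).symm
  continuous_app := continuous_id

/-- The canonical isomorphism `Θ : u_X ∘ Sh(s) ≅ u_X ∘ Sh(t)` of geometric morphisms
`Sh(X₁) → Sh(X)`, which is given by `(g, w) ↦ (g, g · w)`. -/
noncomputable def squareIso (X : TopGrpd.{u}) :
    (shGeom (discMap X.src X.continuous_src)).comp (shGeom (fromObj X)) ≅
      (shGeom (discMap X.tgt X.continuous_tgt)).comp (shGeom (fromObj X)) :=
  shComp _ _ ≪≫ ((shIso _ _).map (arrTrans X)).iso ≪≫ (shComp _ _).symm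

/-- Étale complete topological groupoids: open topological groupoids with sober spaces of objects
and arrows for which
```
  Sh(X₁) --Sh(s)--> Sh(X₀)
    |                 |
  Sh(t)              u_X
    v                 v
  Sh(X₀) ---u_X---> Sh(X)
```
is a bi-pullback of topoi with enough points. -/
structure IsEtaleComplete (X : TopGrpd.{u}) : Prop where
  isOpenGrpd : X.IsOpenGrpd
  quasiSober_obj : QuasiSober X.Obj
  t0_obj : T0Space X.Obj
  quasiSober_arr : QuasiSober X.Arr
  t0_arr : T0Space X.Arr
  isBipullback : IsBipullbackWEP (squareIso X)

end TopGrpd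

/-! Both halves come down to recovering arrows of `Y` from the bi-pullback square. A natural
isomorphism `α : Sh(Φ)^* ≅ Sh(Ψ)^*` acts on fibres by maps `W_{Φ(x)} → W_{Ψ(x)}`, natural in the
sheaf `W` on `Y`. It is to be shown that these are the actions of arrows `k(x) : Φ(x) → Ψ(x)` which
are unique and vary continuously with `x`.

Existence (`IsEtaleComplete.exists_arrows`). Forgetting the arrows of `X`, `α` becomes an
isomorphism `u_Y ∘ Sh(Φ₀) ≅ u_Y ∘ Sh(Ψ₀)` of geometric morphisms out of `Sh(X₀)`, hence a cone over
the square of `Y`. The cone is induced by some `h : Sh(X₀) → Sh(Y₁)`. As `Y₁` is sober, `h` has an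
underlying continuous map `k : X₀ → Y₁`, and `T0` separation of `Y₀` gives `s ∘ k = Φ₀` and `t ∘ k =
Ψ₀`. If `σ` and `τ` are local sections of `W` through `w` and `k(x) · w`, the arrows carrying `σ` to
`τ` form an open neighbourhood of `k(x)`. The compatibility of the cone with the 2-cell, evaluated
over that open set, gives `α(x, w) = (x, k(x) · w)`.

Uniqueness (`IsEtaleComplete.arr_ext`). Two parallel arrows with the same action on all sheaves
induce compatible cones on the one-point topos. Fullness of the comparison functor turns these into
a transformation between the two points of `Sh(Y₁)`, so the arrows have the same open neighbourhoods
and agree by `T0`. This gives faithfulness, and it also gives naturality of `k`, since both sides of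
a naturality square act in the same way.

The bi-pullback may be tested only against Grothendieck topoi with enough points, so this is
verified for `Sh(S)` with `S` a space: étale spaces are equivalent to sheaves on the site of opens,
and fibres supply the points. -/

namespace TopGrpd
namespace Sh

/-! ### Local sections of sheaves on a groupoid. -/

section LocalSections

variable {X : TopGrpd.{u}}

/-- Every point of a sheaf lies on a local section. -/
lemma exists_localSection (W : Sh X) (w : W) :
    ∃ (U : Set X.Obj) (_ : IsOpen U) (h : W.proj w ∈ U) (σ : U → W),
      Continuous σ ∧ (∀ z, W.proj (σ z) = z) ∧ σ ⟨W.proj w, h⟩ = w := by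
  obtain ⟨e, hw, he⟩ := W.str.isLocalHomeomorph_proj w
  have hsymm : ∀ z ∈ e.target, W.proj (e.symm z) = z := fun z hz =>
    (congrFun he (e.symm z)).trans (e.right_inv hz)
  have hproj : W.proj w = e w := congrFun he w
  refine ⟨e.target, e.open_target, hproj ▸ e.map_source hw, fun z => e.symm z.1, ?_,
    fun z => hsymm z z.2, ?_⟩
  · exact continuousOn_iff_continuous_domRestrict.mp e.continuousOn_symm
  · exact (congrArg e.symm hproj).trans (e.left_inv hw)

/-- A section of a local homeomorphism over an open set is itself a local homeomorphism. Hence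
continuity of a map out of `W` at a point can be tested along a section through it. -/
lemma map_nhds_localSection (W : Sh X) {U : Set X.Obj} (hU : IsOpen U) {σ : U → W}
    (hσ : Continuous σ) (hp : ∀ z, W.proj (σ z) = z) (z : U) :
    (𝓝 z).map σ = 𝓝 (σ z) := by
  have hcomp : IsLocalHomeomorph (W.proj ∘ σ) := by
    have : W.proj ∘ σ = Subtype.val := funext hp
    rw [this]
    exact hU.isOpenEmbedding_subtypeVal.isLocalHomeomorph
  exact (IsLocalHomeomorph.of_comp hcomp W.str.isLocalHomeomorph_proj hσ).map_nhds_eq z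

end LocalSections

/-! ### Sheaves on a space: étale spaces against sheaves on the site of opens. -/

section Space

variable {S : Type u} [TopologicalSpace S]

/-- An étale space over `S` as a sheaf on the groupoid `disc S`. -/
def ofEtale {W : Type u} [TopologicalSpace W] (q : W → S) (hq : IsLocalHomeomorph q) :
    Sh (disc S) where
  carrier := W
  str :=
    { proj := q
      isLocalHomeomorph_proj := hq
      act := fun _ w _ => w
      continuous_act := continuous_snd.comp continuous_subtype_val
      proj_act := fun _ _ e => e.symm
      act_one := fun _ => rfl
      act_comp := fun _ _ _ _ _ => rfl }

lemma act_disc (W : Sh (disc S)) (g : (disc S).Arr) (w : W) (e : (disc S).src g = W.proj w) :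
    W.act g w e = w :=
  (act_congr W e rfl e rfl).trans (W.str.act_one w)

/-- Over a space, continuous maps over the base are morphisms of sheaves. -/
def discHom {V W : Sh (disc S)} (f : V → W) (hf : Continuous f)
    (hp : ∀ v, W.proj (f v) = V.proj v) : V ⟶ W where
  toFun := f
  continuous_toFun := hf
  proj_toFun := hp
  map_act g v e := by rw [act_disc, act_disc]

/-- Bijective morphisms of sheaves on a space are isomorphisms. -/
lemma isIso_of_bijective {V W : Sh (disc S)} (f : V ⟶ W)
    (hf : Function.Bijective (Hom.toFun f)) : IsIso f := by
  let e := (Hom.isLocalHomeomorph f).toHomeomorphOfBijective hf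
  have he : ∀ w, Hom.toFun f (e.symm w) = w := fun w => e.apply_symm_apply w
  refine ⟨discHom e.symm e.symm.continuous fun w => ?_, ?_, ?_⟩
  · rw [← Hom.proj_toFun f, he]
  · apply hom_ext
    intro v
    exact e.symm_apply_apply v
  · apply hom_ext
    intro w
    exact he w

/-- The subterminal sheaf of an open subset. -/
def openSheaf (U : Set S) (hU : IsOpen U) : Sh (disc S) :=
  ofEtale (W := U) Subtype.val hU.isOpenEmbedding_subtypeVal.isLocalHomeomorph

open TopologicalSpace Opposite

/-- The sheaf of sections of an étale space. -/
def sectionsSheaf (W : Sh (disc S)) : TopCat.Sheaf (Type u) (TopCat.of S) :=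
  TopCat.subsheafToTypes ((TopCat.continuousLocal (TopCat.of S) W.carrier).and
    (TopCat.isSection (X := TopCat.of S) W.proj))

lemma sectionsSheaf_ext {W : Sh (disc S)} {U : (Opens (TopCat.of S))ᵒᵖ}
    {s t : (sectionsSheaf W).1.obj U} (h : ∀ x, s.1 x = t.1 x) : s = t :=
  Subtype.ext (funext h)

variable (S) in
/-- The functor which sends an étale space to its sheaf of sections. -/
def sectionsFunctor : Sh (disc S) ⥤ TopCat.Sheaf (Type u) (TopCat.of S) where
  obj W := sectionsSheaf W
  map f :=
    ⟨{ app := fun _ => TypeCat.ofHom fun s => ⟨fun x => Hom.toFun f (s.1 x),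
          (Hom.continuous_toFun f).comp s.2.1,
          funext fun x => (Hom.proj_toFun f _).trans (congrFun s.2.2 x)⟩
       naturality := fun _ _ _ => rfl }⟩
  map_id _ := rfl
  map_comp _ _ := rfl

instance : (sectionsFunctor S).Faithful where
  map_injective {V W f g} h := by
    apply hom_ext
    intro v
    obtain ⟨U, hU, hv, σ, hσ, hp, e⟩ := exists_localSection V v
    let s : (sectionsSheaf V).1.obj (op ⟨U, hU⟩) := ⟨σ, hσ, funext hp⟩
    have h1 := congrArg (fun m : sectionsSheaf V ⟶ sectionsSheaf W =>
      (m.1.app (op ⟨U, hU⟩) s).1 ⟨V.proj v, hv⟩) h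
    have h2 : Hom.toFun f (σ ⟨V.proj v, hv⟩) = Hom.toFun g (σ ⟨V.proj v, hv⟩) := h1
    rwa [e] at h2

/-- The value of a morphism of sheaves of sections at a point depends only on the value of the
section. -/
lemma sections_app_congr {V W : Sh (disc S)} (η : sectionsSheaf V ⟶ sectionsSheaf W)
    {U U' : Opens (TopCat.of S)} (s : (sectionsSheaf V).1.obj (op U))
    (t : (sectionsSheaf V).1.obj (op U')) (x : S) (hx : x ∈ U) (hx' : x ∈ U')
    (h : s.1 ⟨x, hx⟩ = t.1 ⟨x, hx'⟩) :
    (η.1.app (op U) s).1 ⟨x, hx⟩ = (η.1.app (op U') t).1 ⟨x, hx'⟩ := by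
  let s' : (U ⊓ U' : Opens (TopCat.of S)) → V := fun z => s.1 ⟨z.1, z.2.1⟩
  let t' : (U ⊓ U' : Opens (TopCat.of S)) → V := fun z => t.1 ⟨z.1, z.2.2⟩
  have hs' : Continuous s' := Continuous.comp s.2.1 (by fun_prop)
  have ht' : Continuous t' := Continuous.comp t.2.1 (by fun_prop)
  have hps : ∀ z, V.proj (s' z) = z.1 := fun z => congrFun s.2.2 ⟨z.1, z.2.1⟩
  have hpt : ∀ z, V.proj (t' z) = z.1 := fun z => congrFun t.2.2 ⟨z.1, z.2.2⟩
  -- Two sections of a local homeomorphism that meet at a point agree on a neighbourhood `N` of it.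
  -- Naturality of `η` under restriction to `N` then compares the two values.
  have hopen : IsOpen {z | s' z = t' z} :=
    V.str.isLocalHomeomorph_proj.isLocallyInjective.isOpen_eqLocus hs' ht'
      (funext fun z => (hps z).trans (hpt z).symm)
  let N : Opens (TopCat.of S) := ⟨Subtype.val '' {z | s' z = t' z},
    (U ⊓ U').isOpen.isOpenMap_subtype_val _ hopen⟩
  have hxN : x ∈ N := ⟨⟨x, hx, hx'⟩, h, rfl⟩
  have hNU : N ≤ U := by
    rintro _ ⟨z, -, rfl⟩
    exact z.2.1
  have hNU' : N ≤ U' := by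
    rintro _ ⟨z, -, rfl⟩
    exact z.2.2
  have hres : (sectionsSheaf V).1.map (homOfLE hNU).op s =
      (sectionsSheaf V).1.map (homOfLE hNU').op t := by
    apply sectionsSheaf_ext
    rintro ⟨_, z, hz, rfl⟩
    exact hz
  have h1 := congrArg (fun m => m s) (η.1.naturality (homOfLE hNU).op)
  have h2 := congrArg (fun m => m t) (η.1.naturality (homOfLE hNU').op)
  have h3 : (sectionsSheaf W).1.map (homOfLE hNU).op (η.1.app (op U) s) =
      (sectionsSheaf W).1.map (homOfLE hNU').op (η.1.app (op U') t) :=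
    h1.symm.trans ((congrArg (η.1.app (op N)) hres).trans h2)
  exact congrArg (fun r : (sectionsSheaf W).1.obj (op N) => r.1 ⟨x, hxN⟩) h3

/-- The map of étale spaces sends `v` to the value, at its base point, of the image under `η` of a
chosen local section through `v`. By `sections_app_congr` the choice does not matter, so along any
local section the map is a section of `W`, and this makes it continuous. -/
instance : (sectionsFunctor S).Full where
  map_surjective {V W} η := by
    change sectionsSheaf V ⟶ sectionsSheaf W at η
    choose U hU hv σ hσ hp e using exists_localSection V
    let s : ∀ v, (sectionsSheaf V).1.obj (op ⟨U v, hU v⟩) := fun v => ⟨σ v, hσ v, funext (hp v)⟩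
    let F : V → W := fun v => (η.1.app _ (s v)).1 ⟨V.proj v, hv v⟩
    have hF : ∀ (O : Opens (TopCat.of S)) (t : (sectionsSheaf V).1.obj (op O)) (x : O),
        F (t.1 x) = (η.1.app _ t).1 x := by
      intro O t x
      have hx : V.proj (t.1 x) = x.1 := congrFun t.2.2 x
      have hxO : V.proj (t.1 x) ∈ O := by rw [hx]; exact x.2
      have hx' : (⟨V.proj (t.1 x), hxO⟩ : O) = x := Subtype.ext hx
      refine (sections_app_congr η (s (t.1 x)) t _ (hv _) hxO ?_).trans ?_
      · exact (e _).trans (congrArg t.1 hx').symm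
      · rw [hx']
    refine ⟨discHom F ?_ ?_, ?_⟩
    · rw [continuous_iff_continuousAt]
      intro v
      have hFσ : F ∘ σ v = (η.1.app _ (s v)).1 := funext fun x => hF ⟨U v, hU v⟩ (s v) x
      have hc : Continuous (F ∘ σ v) := hFσ ▸ (η.1.app _ (s v)).2.1
      have := hc.continuousAt (x := ⟨_, hv v⟩)
      rw [ContinuousAt, ← Filter.tendsto_map'_iff, map_nhds_localSection V (hU v) (hσ v) (hp v),
        Function.comp_apply, e v] at this
      exact this
    · intro v
      exact congrFun (η.1.app _ (s v)).2.2 _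
    · apply Sheaf.hom_ext
      apply NatTrans.ext
      funext O
      ext t
      apply sectionsSheaf_ext
      intro x
      exact hF O.unop t x

/-- The topology of the étale space is generated by the sets of germs of sections. The preimage of
such a set is the locus where two sections have equal germs, which is open because equality of germs
spreads to a neighbourhood. -/
lemma continuous_germ (F : TopCat.Presheaf (Type u) (TopCat.of S)) {U : Opens (TopCat.of S)}
    (s : F.obj (op U)) :
    Continuous fun x : U => (⟨x.1, F.germ U x.1 x.2 s⟩ : F.EtaleSpace) := by
  rw [continuous_generateFrom_iff]
  rintro _ ⟨V, t, rfl⟩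
  rw [isOpen_iff_mem_nhds]
  rintro x ⟨hxV, hx⟩
  obtain ⟨N, hxN, iU, iV, hN⟩ := F.germ_eq _ _ _ _ _ hx
  filter_upwards [N.isOpen.preimage continuous_subtype_val |>.mem_nhds hxN] with z hz
  refine ⟨iV.le hz, ?_⟩
  change F.germ U z.1 z.2 s = F.germ V z.1 _ t
  rw [← F.germ_res_apply iU z.1 hz, hN, F.germ_res_apply]

/-- Openness comes from the continuous sections given by germs. Local injectivity comes from the
basic open sets, on which a germ is determined by its base point. -/
lemma isLocalHomeomorph_base (F : TopCat.Presheaf (Type u) (TopCat.of S)) :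
    IsLocalHomeomorph (TopCat.Presheaf.EtaleSpace.base (F := F)) := by
  refine isLocalHomeomorph_of (TopCat.Presheaf.EtaleSpace.continuous_base F) ?_ ?_
  · rw [isOpenMap_iff_nhds_le]
    rintro ⟨x, g⟩
    obtain ⟨U, hx, s, rfl⟩ := F.exists_germ_eq g
    have h1 := (continuous_germ F s).continuousAt (x := ⟨x, hx⟩)
    have h2 := Filter.map_mono (m := TopCat.Presheaf.EtaleSpace.base (F := F)) h1
    refine le_trans ?_ h2
    rw [Filter.map_map]
    exact (U.isOpen.isOpenEmbedding_subtypeVal.map_nhds_eq ⟨x, hx⟩).ge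
  · rintro ⟨x, g⟩
    obtain ⟨U, hx, s, rfl⟩ := F.exists_germ_eq g
    refine ⟨{g | ∃ h, g.germ = F.germ U g.base h s},
      TopologicalSpace.isOpen_generateFrom_of_mem ⟨U, s, rfl⟩, ⟨hx, rfl⟩, ?_⟩
    rintro ⟨y, g⟩ ⟨hy, hg⟩ ⟨y', g'⟩ ⟨hy', hg'⟩ e
    change y = y' at e
    subst e
    change g = _ at hg
    change g' = _ at hg'
    rw [hg, hg']

/-- The étale space of a sheaf on a space. -/
noncomputable def etaleSheaf (F : TopCat.Sheaf (Type u) (TopCat.of S)) : Sh (disc S) :=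
  ofEtale (S := S) (TopCat.Presheaf.EtaleSpace.base (F := F.1)) (isLocalHomeomorph_base F.1)

/-- The stalk containing `g.germ` depends on `g.base`, so a propositional equality `g.base = x` has
to be transported before germs can be compared. -/
lemma etaleSpace_eq_mk {F : TopCat.Presheaf (Type u) (TopCat.of S)} {U : Opens (TopCat.of S)}
    (s : F.obj (op U)) {g : F.EtaleSpace} {x : S} (hx : g.base = x) (h : g.base ∈ U)
    (hg : g.germ = F.germ U g.base h s) :
    ∃ hxU : x ∈ U, g = ⟨x, F.germ U x hxU s⟩ := by
  obtain ⟨y, g⟩ := g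
  change y = x at hx
  subst hx
  exact ⟨h, congrArg _ hg⟩

/-- The map which sends a section to its germs. -/
noncomputable def toSections (F : TopCat.Sheaf (Type u) (TopCat.of S)) :
    F ⟶ sectionsSheaf (etaleSheaf F) :=
  ⟨{ app := fun U => TypeCat.ofHom fun s =>
        ⟨fun x => ⟨x.1, F.presheaf.germ U.unop x.1 x.2 s⟩, continuous_germ F.1 s, rfl⟩
     naturality := fun U V i => by
        ext s
        apply sectionsSheaf_ext
        intro x
        exact congrArg (TopCat.Presheaf.EtaleSpace.mk x.1) (F.presheaf.germ_res_apply i.unop x.1 x.2 s) }⟩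

/-- Separatedness of `F` gives injectivity. For surjectivity, a continuous section of the étale
space is locally given by the germs of sections of `F`; on overlaps these have equal germs, so they
glue. -/
lemma toSections_bijective (F : TopCat.Sheaf (Type u) (TopCat.of S)) (U : Opens (TopCat.of S)) :
    Function.Bijective ((toSections F).1.app (op U)) := by
  have hgerm : ∀ {V : Opens (TopCat.of S)} (s : F.1.obj (op V)) (x : V),
      ((toSections F).1.app (op V) s).1 x = ⟨x.1, F.presheaf.germ V x.1 x.2 s⟩ := fun _ _ => rfl
  constructor
  · intro s t h
    apply TopCat.Presheaf.section_ext F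
    intro x hx
    have h1 := congrArg (fun r : (sectionsSheaf (etaleSheaf F)).1.obj (op U) => r.1 ⟨x, hx⟩) h
    simp only [hgerm] at h1
    injection h1
  · intro t
    have hloc : ∀ x : U, ∃ (V : Opens (TopCat.of S)) (_ : x.1 ∈ V) (hVU : V ≤ U)
        (s : F.1.obj (op V)), ∀ y : V, t.1 ⟨y.1, hVU y.2⟩ = ⟨y.1, F.presheaf.germ V y.1 y.2 s⟩ := by
      intro x
      obtain ⟨O, hO, s, hs⟩ := F.presheaf.exists_germ_eq (t.1 x).germ
      have h1 := (TopCat.Presheaf.EtaleSpace.eventually_nhds (t.1 x) hO s hs)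
      have h2 := (t.2.1.continuousAt (x := x)).eventually h1
      obtain ⟨N, hN, hNo, hxN⟩ := eventually_nhds_iff.1 h2
      have key : ∀ y : U, y ∈ N → ∃ hy : y.1 ∈ O, t.1 y = ⟨y.1, F.presheaf.germ O y.1 hy s⟩ := by
        intro y hy
        obtain ⟨h3, h4⟩ := hN y hy
        exact etaleSpace_eq_mk s (congrFun t.2.2 y) h3 h4
      let V : Opens (TopCat.of S) := ⟨Subtype.val '' N, U.isOpen.isOpenMap_subtype_val _ hNo⟩
      have hVU : V ≤ U := by
        rintro _ ⟨y, -, rfl⟩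
        exact y.2
      have hVO : V ≤ O := by
        rintro _ ⟨y, hy, rfl⟩
        exact (key y hy).1
      refine ⟨V, ⟨x, hxN, rfl⟩, hVU, F.1.map (homOfLE hVO).op s, ?_⟩
      rintro ⟨_, y, hy, rfl⟩
      refine (key y hy).2.trans (congrArg (TopCat.Presheaf.EtaleSpace.mk y.1) ?_)
      exact (F.presheaf.germ_res_apply (homOfLE hVO) _ _ s).symm
    choose V hxV hVU s hs using hloc
    have hcover : U ≤ iSup V := fun x hx => Opens.mem_iSup.2 ⟨⟨x, hx⟩, hxV ⟨x, hx⟩⟩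
    obtain ⟨r, hr, -⟩ := F.existsUnique_gluing' V U (fun x => homOfLE (hVU x)) hcover s (by
      intro x y
      apply TopCat.Presheaf.section_ext F
      intro z hz
      have h1 := (hs x ⟨z, hz.1⟩).symm.trans (hs y ⟨z, hz.2⟩)
      injection h1 with _ h2
      exact (F.presheaf.germ_res_apply (Opens.infLELeft _ _) z hz (s x)).trans
        (h2.trans
          (F.presheaf.germ_res_apply (Opens.infLERight _ _) z hz (s y)).symm))
    refine ⟨r, ?_⟩
    apply sectionsSheaf_ext
    intro x
    refine (hgerm r x).trans ((hs x ⟨x, hxV x⟩).trans ?_).symm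
    have := hr x
    rw [← this, F.presheaf.germ_res_apply]

instance : (sectionsFunctor S).EssSurj where
  mem_essImage F := by
    refine ⟨etaleSheaf F, ⟨Iso.symm ?_⟩⟩
    have : IsIso (toSections F).1 := by
      rw [NatTrans.isIso_iff_isIso_app]
      intro U
      rw [isIso_iff_bijective]
      exact toSections_bijective F U.unop
    have hiso : IsIso (toSections F) :=
      (isIso_iff_of_reflects_iso _ (TopCat.Sheaf.forget (Type u) (TopCat.of S))).1 this
    exact @asIso _ _ _ _ (toSections F) hiso

/-- First half of what is needed to use `Sh(S)` as a test object for the bi-pullback;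
`toposHasEnoughPoints_disc` is the other. -/
lemma isGrothendieckTopos_disc : IsGrothendieckTopos (Sh (disc S)) := by
  have : (sectionsFunctor S).IsEquivalence := {}
  exact ⟨Opens (TopCat.of S), inferInstance, Opens.grothendieckTopology (TopCat.of S),
    ⟨(sectionsFunctor S).asEquivalence⟩⟩

end Space

/-! ### Enough points for sheaves on a space. -/

section Points

/-- The underlying set of a sheaf on the point. -/
def forgetPoint : Sh (disc PUnit.{u + 1}) ⥤ Type u where
  obj W := W.carrier
  map f := TypeCat.ofHom (Hom.toFun f)
  map_id _ := rfl
  map_comp _ _ := rfl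

lemma discreteTopology_of_point (W : Sh (disc PUnit.{u + 1})) : DiscreteTopology W := by
  have : DiscreteTopology (disc PUnit.{u + 1}).Obj := inferInstanceAs (DiscreteTopology PUnit)
  exact W.str.isLocalHomeomorph_proj.comap_discreteTopology

instance : forgetPoint.{u}.Faithful where
  map_injective {V W f g} h := by
    apply hom_ext
    intro v
    exact congrArg (fun m => m v) h

instance : forgetPoint.{u}.Full where
  map_surjective {V W} f := by
    have := discreteTopology_of_point V
    exact ⟨discHom f continuous_of_discreteTopology fun _ => rfl, rfl⟩

instance : forgetPoint.{u}.EssSurj where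
  mem_essImage A := by
    let _ : TopologicalSpace A := ⊥
    have : DiscreteTopology A := ⟨rfl⟩
    refine ⟨ofEtale (S := PUnit.{u + 1}) (W := A) (fun _ => PUnit.unit) ?_, ⟨Iso.refl _⟩⟩
    exact isLocalHomeomorph_of continuous_const (fun _ _ => isOpen_discrete _)
      (fun a => ⟨{a}, isOpen_discrete _, rfl, Set.injOn_singleton _ _⟩)

/-- Points of a topos are geometric morphisms from `Type u`, while a point of `S` gives one from
`Sh(pt)`. This equivalence converts one into the other and supplies the adjoint and the left
exactness in `pointGeom`. -/
instance : forgetPoint.{u}.IsEquivalence := {}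

variable {S : Type u} [TopologicalSpace S]

/-- The point of the topos `Sh(S)` given by a point of `S`. Its inverse image sends an étale space
to its fibre. -/
noncomputable def pointGeom (x : S) : GeomMorphism (Type u) (Sh (disc S)) where
  inv := inverseImage (discMap (fun _ : PUnit.{u + 1} => x) continuous_const) ⋙ forgetPoint
  dir := _
  adj := Adjunction.ofIsLeftAdjoint _
  leftExact := comp_preservesFiniteLimits _ _

/-- A morphism that is bijective on the fibre over each point of `S` is bijective, and a bijective
morphism is an isomorphism because it is a local homeomorphism. -/
lemma toposHasEnoughPoints_disc : ToposHasEnoughPoints (Sh (disc S)) := by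
  intro A B f hf
  have hbij : ∀ x : S, Function.Bijective ((pointGeom x).inv.map f) := fun x =>
    (isIso_iff_bijective _).1 (hf (pointGeom x))
  apply isIso_of_bijective
  constructor
  · intro a a' h
    have hp : A.proj a = A.proj a' := by rw [← Hom.proj_toFun f, h, Hom.proj_toFun f]
    have h1 := (hbij (A.proj a)).1
      (a₁ := (⟨(PUnit.unit, a), rfl⟩ : {p : PUnit × A // A.proj a = A.proj p.2}))
      (a₂ := (⟨(PUnit.unit, a'), hp⟩ : {p : PUnit × A // A.proj a = A.proj p.2}))
      (Subtype.ext (Prod.ext rfl h))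
    exact congrArg (fun p : {p : PUnit × A // A.proj a = A.proj p.2} => p.1.2) h1
  · intro b
    obtain ⟨p, hp⟩ := (hbij (B.proj b)).2
      (⟨(PUnit.unit, b), rfl⟩ : {p : PUnit × B // B.proj b = B.proj p.2})
    exact ⟨p.1.2, congrArg (fun p : {p : PUnit × B // B.proj b = B.proj p.2} => p.1.2) hp⟩

end Points

end Sh

/-! ### Testing the bi-pullback on spaces; separation of arrows by sheaves. -/

/-- Used twice: for the one-point space, where fullness separates arrows, and for `X.Obj`, where
essential surjectivity produces them. -/
lemma IsEtaleComplete.isEquivalence_toCone {Y : TopGrpd.{u}} (hY : Y.IsEtaleComplete)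
    (S : Type u) [TopologicalSpace S] :
    (GeomMorphism.toConeFunctor (Sh (disc S)) (squareIso Y)).IsEquivalence :=
  hY.isBipullback _ Sh.isGrothendieckTopos_disc Sh.toposHasEnoughPoints_disc

/-- Change of the lift in a pullback of an étale space. -/
def changeLift {S Z B : Type u} [TopologicalSpace S] [TopologicalSpace Z] [TopologicalSpace B]
    {f : Z → B} (hf : Continuous f) {k k' : S → Z} (hk : Continuous k) (hk' : Continuous k')
    (h : ∀ x, f (k x) = f (k' x)) :
    Sh.inverseImage (discMap f hf) ⋙ Sh.inverseImage (discMap k hk) ⟶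
      Sh.inverseImage (discMap f hf) ⋙ Sh.inverseImage (discMap k' hk') where
  app W := Sh.discHom
    (V := Sh.invObj (discMap k hk) (Sh.invObj (discMap f hf) W))
    (W := Sh.invObj (discMap k' hk') (Sh.invObj (discMap f hf) W))
    (fun p => ⟨(p.1.1, ⟨(k' p.1.1, p.1.2.1.2),
      (h p.1.1).symm.trans ((congrArg f p.2).trans p.1.2.2)⟩), rfl⟩)
    (by
      refine Continuous.subtype_mk (.prodMk (by fun_prop) (Continuous.subtype_mk (.prodMk ?_ ?_) _)) _
      · exact hk'.comp (continuous_fst.comp continuous_subtype_val)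
      · exact continuous_snd.comp (continuous_subtype_val.comp
          (continuous_snd.comp continuous_subtype_val)))
    (fun _ => rfl)
  naturality _ _ _ := rfl

/-- Arrows of an étale complete groupoid are determined by their action on sheaves. -/
lemma IsEtaleComplete.arr_ext {Y : TopGrpd.{u}} (hY : Y.IsEtaleComplete) {g g' : Y.Arr}
    (hs : Y.src g = Y.src g') (ht : Y.tgt g = Y.tgt g')
    (h : ∀ (W : Sh Y) (w : W) (e : Y.src g = W.proj w), W.act g w e = W.act g' w (hs.symm.trans e)) :
    g = g' := by
  have := hY.t0_arr
  -- The hypotheses are symmetric in `g` and `g'`, so by `T0` separation one inclusion of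
  -- neighbourhood systems suffices.
  suffices key : ∀ {g g' : Y.Arr} (hs : Y.src g = Y.src g') (_ : Y.tgt g = Y.tgt g'),
      (∀ (W : Sh Y) (w : W) (e : Y.src g = W.proj w),
        W.act g w e = W.act g' w (hs.symm.trans e)) → ∀ U, IsOpen U → g ∈ U → g' ∈ U by
    refine (inseparable_iff_forall_isOpen.2 fun U hU => ⟨key hs ht h U hU, ?_⟩).eq
    exact key hs.symm ht.symm (fun W w e => (h W w (hs.trans e)).symm) U hU
  clear! g g'
  intro g g' hs ht h U hU hg
  have := hY.isEquivalence_toCone PUnit.{u + 1}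
  let k : GeomMorphism (Sh (disc PUnit.{u + 1})) (Sh (disc Y.Arr)) :=
    shGeom (discMap (fun _ => g) continuous_const)
  let k' : GeomMorphism (Sh (disc PUnit.{u + 1})) (Sh (disc Y.Arr)) :=
    shGeom (discMap (fun _ => g') continuous_const)
  let F := GeomMorphism.toConeFunctor (Sh (disc PUnit.{u + 1})) (squareIso Y)
  -- The legs identify fibres over the equal sources and over the equal targets. Their compatibility
  -- with the 2-cell `(g, w) ↦ (g, g · w)` is exactly the assumption that `g` and `g'` act alike.
  let m : F.obj k ⟶ F.obj k' :=
    { fst := changeLift Y.continuous_src continuous_const continuous_const (fun _ => hs)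
      snd := changeLift Y.continuous_tgt continuous_const continuous_const (fun _ => ht)
      w := by
        apply NatTrans.ext
        funext W
        apply Sh.hom_ext
        rintro ⟨⟨x, ⟨⟨g₀, ⟨⟨y, w⟩, e1⟩⟩, e2⟩⟩, e3⟩
        change g = g₀ at e3
        subst e3
        change Y.src g = y at e2
        subst e2
        apply Subtype.ext
        refine Prod.ext rfl (Subtype.ext (Prod.ext rfl (Subtype.ext (Prod.ext ?_ ?_))))
        · exact ht.symm
        · exact (h W w e1).symm }
  obtain ⟨α, -⟩ := F.map_surjective m
  -- The fibre of the subterminal sheaf `U` at an arrow is inhabited exactly when the arrow lies in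
  -- `U`, and `α` maps the fibre at `g` to the fibre at `g'`.
  let e : (k.inv.obj (Sh.openSheaf U hU)).carrier := ⟨(PUnit.unit, ⟨g, hg⟩), rfl⟩
  let e' : (k'.inv.obj (Sh.openSheaf U hU)).carrier :=
    Sh.Hom.toFun (NatTrans.app α (Sh.openSheaf U hU)) e
  have : g' = e'.1.2.1 := e'.2
  rw [this]
  exact e'.1.2.2

namespace Sh

/-! ### Geometric morphisms between spaces and their underlying continuous maps. -/

section Frame

variable {S Z : Type u} [TopologicalSpace S] [TopologicalSpace Z]

def openSheafMap {U V : Set Z} (hU : IsOpen U) (hV : IsOpen V) (h : U ⊆ V) :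
    openSheaf U hU ⟶ openSheaf V hV :=
  discHom (V := openSheaf U hU) (W := openSheaf V hV) (fun z => ⟨z.1, h z.2⟩)
    (Continuous.subtype_mk continuous_subtype_val _) (fun _ => rfl)

/-- The section of a sheaf over an open set, as a morphism. -/
def sectionHom (W : Sh (disc Z)) {U : Set Z} (hU : IsOpen U) (σ : U → W) (hσ : Continuous σ)
    (hp : ∀ z, W.proj (σ z) = z.1) : openSheaf U hU ⟶ W :=
  discHom (V := openSheaf U hU) σ hσ hp

/-- The projection of a subterminal sheaf is injective. -/
lemma proj_injective_of_subterminal (W : Sh (disc Z))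
    (hW : ∀ (V : Sh (disc Z)) (f g : V ⟶ W), f = g) : Function.Injective W.proj := by
  intro w w' h
  obtain ⟨U, hU, hw, σ, hσ, hp, e⟩ := exists_localSection W w
  obtain ⟨U', hU', hw', σ', hσ', hp', e'⟩ := exists_localSection W w'
  have hz : W.proj w ∈ U ∩ U' := ⟨hw, h ▸ hw'⟩
  -- The two local sections, restricted to the common domain, are parallel morphisms into `W`.
  have key := hW _
    (openSheafMap (hU.inter hU') hU Set.inter_subset_left ≫ sectionHom W hU σ hσ hp)
    (openSheafMap (hU.inter hU') hU' Set.inter_subset_right ≫ sectionHom W hU' σ' hσ' hp')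
  have h1 : σ ⟨W.proj w, hw⟩ = σ' ⟨W.proj w, hz.2⟩ :=
    congrArg (fun m : openSheaf (U ∩ U') (hU.inter hU') ⟶ W => Hom.toFun m ⟨W.proj w, hz⟩) key
  rw [← e, h1, ← e']
  exact congrArg σ' (Subtype.ext h)

lemma hom_openSheaf_unique {V : Sh (disc Z)} {U : Set Z} {hU : IsOpen U}
    (f g : V ⟶ openSheaf U hU) : f = g := by
  apply hom_ext
  intro v
  exact Subtype.ext ((Hom.proj_toFun f v).trans (Hom.proj_toFun g v).symm)

/-- The whole space is terminal. -/
noncomputable def isTerminalOpenSheafUniv :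
    IsTerminal (openSheaf (Set.univ : Set Z) isOpen_univ) :=
  isTerminalOfBijective _ ⟨Subtype.val_injective, fun z => ⟨⟨z, trivial⟩, rfl⟩⟩

variable (h : GeomMorphism (Sh (disc S)) (Sh (disc Z)))

/-- The inverse image of an open set under a geometric morphism of spaces. -/
def preimageOpen (U : Set Z) (hU : IsOpen U) : Set S :=
  Set.range (h.inv.obj (openSheaf U hU)).proj

lemma isOpen_preimageOpen (U : Set Z) (hU : IsOpen U) : IsOpen (preimageOpen h U hU) :=
  (h.inv.obj (openSheaf U hU)).str.isLocalHomeomorph_proj.isOpenMap.isOpen_range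

lemma preimageOpen_of_hom {V : Sh (disc Z)} {U : Set Z} {hU : IsOpen U} (f : V ⟶ openSheaf U hU)
    (v : h.inv.obj V) : (h.inv.obj V).proj v ∈ preimageOpen h U hU :=
  ⟨Hom.toFun (h.inv.map f) v, Hom.proj_toFun _ _⟩

lemma preimageOpen_mono {U V : Set Z} (hU : IsOpen U) (hV : IsOpen V) (hUV : U ⊆ V) :
    preimageOpen h U hU ⊆ preimageOpen h V hV := by
  rintro _ ⟨e, rfl⟩
  exact preimageOpen_of_hom h (openSheafMap hU hV hUV) e

/-- The inverse image of the terminal sheaf is terminal, hence has a global section. -/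
lemma preimageOpen_univ (x : S) : x ∈ preimageOpen h Set.univ isOpen_univ := by
  have := h.leftExact
  let m : terminal (disc S) ⟶ h.inv.obj (openSheaf (Set.univ : Set Z) isOpen_univ) :=
    (isTerminalOpenSheafUniv.isTerminalObj h.inv).from _
  exact ⟨Hom.toFun m x, Hom.proj_toFun m x⟩

/-- As a subterminal sheaf, `U ∩ V` is the pullback of `U` and `V` over the whole space, and `h.inv`
preserves this pullback. Points of the two inverse images over the same `x` agree in the inverse
image of the whole space, so they define a point of the pullback. -/
lemma preimageOpen_inter {U V : Set Z} (hU : IsOpen U) (hV : IsOpen V) {x : S}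
    (hxU : x ∈ preimageOpen h U hU) (hxV : x ∈ preimageOpen h V hV) :
    x ∈ preimageOpen h (U ∩ V) (hU.inter hV) := by
  have := h.leftExact
  obtain ⟨a, rfl⟩ := hxU
  obtain ⟨b, hb⟩ := hxV
  have hT : Function.Injective (h.inv.obj (openSheaf (Set.univ : Set Z) isOpen_univ)).proj := by
    exact proj_injective_of_subterminal _ fun V f g =>
      (isTerminalOpenSheafUniv.isTerminalObj h.inv).hom_ext f g
  have hpb : IsPullback (openSheafMap (hU.inter hV) hU Set.inter_subset_left)
      (openSheafMap (hU.inter hV) hV Set.inter_subset_right)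
      (openSheafMap hU isOpen_univ (Set.subset_univ _))
      (openSheafMap hV isOpen_univ (Set.subset_univ _)) := by
    refine isPullback_of_bijective (hom_openSheaf_unique _ _) ?_ ?_
    · intro z z' e _
      exact Subtype.ext (congrArg (fun t : U => t.1) e)
    · rintro ⟨z, hz⟩ ⟨z', hz'⟩ e
      have e : z = z' := congrArg (fun t : (Set.univ : Set Z) => t.1) e
      subst e
      exact ⟨⟨z, hz, hz'⟩, rfl, rfl⟩
  have hpb' := hpb.map h.inv
  let p : fibProd (h.inv.map (openSheafMap hU isOpen_univ (Set.subset_univ _)))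
      (h.inv.map (openSheafMap hV isOpen_univ (Set.subset_univ _))) := ⟨(a, b), by
    apply hT
    rw [Hom.proj_toFun, Hom.proj_toFun, hb]⟩
  let m := hpb'.lift _ _ (fibProd_w (h.inv.map (openSheafMap hU isOpen_univ (Set.subset_univ _)))
      (h.inv.map (openSheafMap hV isOpen_univ (Set.subset_univ _))))
  exact ⟨Hom.toFun m p, Hom.proj_toFun m p⟩

/-- This is preservation of unions by a left adjoint, in terms of open sets. With `O` the union of
the inverse images, each member of `A` maps to `h.dir O` by adjunction. As `h.dir O` is again
subterminal, these maps assemble to a map from `⋃₀ A`, whose transpose lands in `O`. -/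
lemma preimageOpen_sUnion {A : Set (Set Z)} (hA : ∀ U ∈ A, IsOpen U) {x : S}
    (hx : x ∈ preimageOpen h (⋃₀ A) (isOpen_sUnion hA)) :
    ∃ U, ∃ hU : U ∈ A, x ∈ preimageOpen h U (hA U hU) := by
  let O : Set S := {x | ∃ U, ∃ hU : U ∈ A, x ∈ preimageOpen h U (hA U hU)}
  have hO : IsOpen O := by
    have : O = ⋃ U, ⋃ hU : U ∈ A, preimageOpen h U (hA U hU) := by
      ext
      simp [O]
    rw [this]
    exact isOpen_iUnion fun U => isOpen_iUnion fun hU => isOpen_preimageOpen h U _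
  let D : Sh (disc Z) := h.dir.obj (openSheaf O hO)
  have hD : Function.Injective D.proj := by
    refine proj_injective_of_subterminal _ fun V f g => ?_
    apply (h.adj.homEquiv _ _).symm.injective
    exact hom_openSheaf_unique _ _
  have hDe : IsOpenEmbedding D.proj := D.str.isLocalHomeomorph_proj.isOpenEmbedding_of_injective hD
  have hmem : ∀ z : ⋃₀ A, ∃ d : D, D.proj d = z.1 := by
    rintro ⟨z, U, hU, hz⟩
    let f : h.inv.obj (openSheaf U (hA U hU)) ⟶ openSheaf O hO :=
      discHom (W := openSheaf O hO)
        (fun v => ⟨(h.inv.obj (openSheaf U (hA U hU))).proj v, U, hU, ⟨v, rfl⟩⟩)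
        (Continuous.subtype_mk (continuous_proj _) _) (fun _ => rfl)
    let f' := h.adj.homEquiv _ _ f
    exact ⟨Hom.toFun f' ⟨z, hz⟩, Hom.proj_toFun f' _⟩
  choose d hd using hmem
  have hdc : Continuous d := by
    rw [hDe.isInducing.continuous_iff]
    have : D.proj ∘ d = Subtype.val := funext hd
    rw [this]
    exact continuous_subtype_val
  let m := (h.adj.homEquiv _ _).symm (sectionHom D (isOpen_sUnion hA) d hdc hd)
  obtain ⟨e, rfl⟩ := hx
  have h1 := (Hom.toFun m e).2
  have h2 : (Hom.toFun m e).1 = _ := Hom.proj_toFun m e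
  rwa [h2] at h1

/-- A geometric morphism from a space to a sober space is given by a continuous map on opens. -/
lemma exists_continuous_of_geomMorphism [QuasiSober Z] :
    ∃ k : S → Z, Continuous k ∧ ∀ (U : Set Z) (hU : IsOpen U) (x : S),
      k x ∈ U ↔ x ∈ preimageOpen h U hU := by
  have key : ∀ x : S, ∃ z : Z, ∀ (U : Set Z) (hU : IsOpen U), z ∈ U ↔ x ∈ preimageOpen h U hU := by
    intro x
    -- The value `k x` will be a generic point of the complement of `⋃₀ A`, the largest open set
    -- whose inverse image misses `x`.
    let A : Set (Set Z) := {U | ∃ hU : IsOpen U, x ∉ preimageOpen h U hU}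
    have hA : ∀ U ∈ A, IsOpen U := fun U hU => hU.1
    have hN : x ∉ preimageOpen h (⋃₀ A) (isOpen_sUnion hA) := by
      intro hx
      obtain ⟨U, hU, hxU⟩ := preimageOpen_sUnion h hA hx
      exact hU.2 hxU
    have meets : ∀ (U : Set Z) (hU : IsOpen U),
        ((⋃₀ A)ᶜ ∩ U).Nonempty ↔ x ∈ preimageOpen h U hU := by
      intro U hU
      constructor
      · rintro ⟨z, hz, hzU⟩
        by_contra hx
        exact hz ⟨U, ⟨hU, hx⟩, hzU⟩
      · intro hx
        by_contra hne
        refine hN (preimageOpen_mono h hU _ (fun z hz => ?_) hx)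
        by_contra hz'
        exact hne ⟨z, hz', hz⟩
    have hirr : IsIrreducible (⋃₀ A)ᶜ := by
      constructor
      · exact ((meets Set.univ isOpen_univ).2 (preimageOpen_univ h x)).mono Set.inter_subset_left
      · intro U V hU hV hUF hVF
        exact (meets _ (hU.inter hV)).2
          (preimageOpen_inter h hU hV ((meets U hU).1 hUF) ((meets V hV).1 hVF))
    obtain ⟨z, hz⟩ := QuasiSober.sober hirr (isOpen_sUnion hA).isClosed_compl
    exact ⟨z, fun U hU => (hz.mem_open_set_iff hU).trans (meets U hU)⟩
  choose k hk using key
  refine ⟨k, ⟨fun U hU => ?_⟩, fun U hU x => hk x U hU⟩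
  convert isOpen_preimageOpen h U hU using 1
  ext x
  exact hk x U hU

/-- If the composite of `h` with a continuous map `f` is given by a continuous map `φ`, then
`f ∘ k = φ` for the continuous map `k` underlying `h`. -/
lemma comp_eq_of_iso {B : Type u} [TopologicalSpace B] [T0Space B] {k : S → Z}
    (hk : ∀ (U : Set Z) (hU : IsOpen U) (x : S), k x ∈ U ↔ x ∈ preimageOpen h U hU)
    {f : Z → B} (hf : Continuous f) {φ : S → B} (hφ : Continuous φ)
    (β : h.comp (shGeom (discMap f hf)) ≅ shGeom (discMap φ hφ)) (x : S) : f (k x) = φ x := by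
  refine (inseparable_iff_forall_isOpen.2 fun V hV => ?_).eq
  -- By `T0` separation it is enough that `f (k x)` and `φ x` lie in the same open sets `V`. Both
  -- memberships say that a fibre over `x` is inhabited: that of `h.inv (f ⁻¹' V)` and that of `φ^*
  -- V`. The maps `i` and `j` identify `f ⁻¹' V` with `f^* V`, so that `β` can compare these fibres.
  let i : openSheaf (f ⁻¹' V) (hV.preimage hf) ⟶
      (inverseImage (discMap f hf)).obj (openSheaf V hV) :=
    discHom (V := openSheaf (f ⁻¹' V) (hV.preimage hf)) (W := invObj (discMap f hf) (openSheaf V hV))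
      (fun z => ⟨(z.1, ⟨f z.1, z.2⟩), rfl⟩)
      (Continuous.subtype_mk (.prodMk continuous_subtype_val
        (Continuous.subtype_mk (hf.comp continuous_subtype_val) _)) _) (fun _ => rfl)
  let j : (inverseImage (discMap f hf)).obj (openSheaf V hV) ⟶
      openSheaf (f ⁻¹' V) (hV.preimage hf) :=
    discHom (V := invObj (discMap f hf) (openSheaf V hV)) (W := openSheaf (f ⁻¹' V) (hV.preimage hf))
      (fun p => ⟨p.1.1,
        (congrArg (· ∈ V) (show f p.1.1 = p.1.2.1 from p.2)).mpr p.1.2.2⟩)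
      (Continuous.subtype_mk (continuous_fst.comp continuous_subtype_val) _) (fun _ => rfl)
  have h1 : f (k x) ∈ V ↔ x ∈ preimageOpen h (f ⁻¹' V) (hV.preimage hf) :=
    hk (f ⁻¹' V) (hV.preimage hf) x
  rw [h1]
  constructor
  · rintro ⟨e, rfl⟩
    let e' := Hom.toFun (h.inv.map i ≫ NatTrans.app β.hom (openSheaf V hV)) e
    have e1 : e'.1.1 = (h.inv.obj (openSheaf (f ⁻¹' V) (hV.preimage hf))).proj e :=
      Hom.proj_toFun (h.inv.map i ≫ NatTrans.app β.hom (openSheaf V hV)) e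
    have e2 : φ e'.1.1 = e'.1.2.1 := e'.2
    rw [← e1, e2]
    exact e'.1.2.2
  · intro hx
    let e : (inverseImage (discMap φ hφ)).obj (openSheaf V hV) := ⟨(x, ⟨φ x, hx⟩), rfl⟩
    let n : (inverseImage (discMap φ hφ)).obj (openSheaf V hV) ⟶
      h.inv.obj (openSheaf (f ⁻¹' V) (hV.preimage hf)) :=
        NatTrans.app β.inv (openSheaf V hV) ≫ h.inv.map j
    exact ⟨Hom.toFun n e, Hom.proj_toFun n e⟩

end Frame

end Sh

variable {X Y : TopGrpd.{u}}

/-! ### Restricting a transformation to the space of objects. -/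

section Restrict

variable {Φ Ψ Θ : ContFunctor X Y}

/-- The component of a transformation of inverse images at a point `x`, as a map `W_{Φ(x)} → W`. -/
def transMap (α : Sh.inverseImage Φ ⟶ Sh.inverseImage Ψ) (W : Sh Y) (x : X.Obj) (w : W)
    (e : Φ.obj x = W.proj w) : W :=
  (Sh.Hom.toFun (α.app W) (⟨(x, w), e⟩ : (Sh.invObj Φ W).carrier) : (Sh.invObj Ψ W).carrier).1.2

/-- Sheaf morphisms preserve base points only up to a propositional equality. Splitting off the base
coordinate allows `α` to be treated as a family of maps between fibres of `W`. -/
lemma toFun_eq_transMap (α : Sh.inverseImage Φ ⟶ Sh.inverseImage Ψ) (W : Sh Y)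
    (p : (Sh.invObj Φ W).carrier) :
    (Sh.Hom.toFun (α.app W) p : (Sh.invObj Ψ W).carrier).1 =
      (p.1.1, transMap α W p.1.1 p.1.2 p.2) :=
  Prod.ext (Sh.Hom.proj_toFun (α.app W) p) rfl

lemma proj_transMap (α : Sh.inverseImage Φ ⟶ Sh.inverseImage Ψ) (W : Sh Y) (x : X.Obj) (w : W)
    (e : Φ.obj x = W.proj w) : Ψ.obj x = W.proj (transMap α W x w e) := by
  let p : (Sh.invObj Φ W).carrier := ⟨(x, w), e⟩
  let q : (Sh.invObj Ψ W).carrier := Sh.Hom.toFun (α.app W) p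
  have h1 : Ψ.obj q.1.1 = W.proj q.1.2 := q.2
  have h2 : q.1.1 = x := Sh.Hom.proj_toFun (α.app W) p
  rwa [h2] at h1

lemma transMap_comp (α : Sh.inverseImage Φ ⟶ Sh.inverseImage Ψ)
    (β : Sh.inverseImage Ψ ⟶ Sh.inverseImage Θ) (W : Sh Y) (x : X.Obj) (w : W)
    (e : Φ.obj x = W.proj w) :
    transMap (α ≫ β) W x w e = transMap β W x (transMap α W x w e) (proj_transMap α W x w e) := by
  have h : (Sh.Hom.toFun (α.app W) (⟨(x, w), e⟩ : (Sh.invObj Φ W).carrier) :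
      (Sh.invObj Ψ W).carrier) = ⟨(x, transMap α W x w e), proj_transMap α W x w e⟩ :=
    Subtype.ext (toFun_eq_transMap α W _)
  exact congrArg (fun q : (Sh.invObj Ψ W).carrier =>
    (Sh.Hom.toFun (β.app W) q : (Sh.invObj Θ W).carrier).1.2) h

lemma transMap_naturality (α : Sh.inverseImage Φ ⟶ Sh.inverseImage Ψ) {V W : Sh Y} (f : V ⟶ W)
    (x : X.Obj) (v : V) (e : Φ.obj x = V.proj v) :
    transMap α W x (Sh.Hom.toFun f v) (e.trans (Sh.Hom.proj_toFun f v).symm) =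
      Sh.Hom.toFun f (transMap α V x v e) :=
  congrArg (fun m : (Sh.inverseImage Φ).obj V ⟶ (Sh.inverseImage Ψ).obj W =>
    (Sh.Hom.toFun m (⟨(x, v), e⟩ : (Sh.invObj Φ V).carrier) : (Sh.invObj Ψ W).carrier).1.2)
    (α.naturality f)

/-- The restriction of a transformation of inverse images to the space of objects. -/
def restrictObj (α : Sh.inverseImage Φ ⟶ Sh.inverseImage Ψ) :
    Sh.inverseImage (fromObj Y) ⋙ Sh.inverseImage (discMap Φ.obj Φ.continuous_obj) ⟶
      Sh.inverseImage (fromObj Y) ⋙ Sh.inverseImage (discMap Ψ.obj Ψ.continuous_obj) where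
  app W := Sh.discHom
    (V := Sh.invObj (discMap Φ.obj Φ.continuous_obj) (Sh.invObj (fromObj Y) W))
    (W := Sh.invObj (discMap Ψ.obj Ψ.continuous_obj) (Sh.invObj (fromObj Y) W))
    (fun p => ⟨(p.1.1, ⟨(Ψ.obj p.1.1, transMap α W p.1.1 p.1.2.1.2 (p.2.trans p.1.2.2)),
      proj_transMap α W _ _ _⟩), rfl⟩)
    (by
      refine Continuous.subtype_mk (.prodMk (by fun_prop) (Continuous.subtype_mk (.prodMk ?_ ?_) _)) _
      · exact Ψ.continuous_obj.comp (continuous_fst.comp continuous_subtype_val)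
      · refine continuous_snd.comp (continuous_subtype_val.comp
          ((Sh.Hom.continuous_toFun (α.app W)).comp
            (Continuous.subtype_mk (.prodMk ?_ ?_) _)))
        · exact continuous_fst.comp continuous_subtype_val
        · exact continuous_snd.comp (continuous_subtype_val.comp
            (continuous_snd.comp continuous_subtype_val)))
    (fun _ => rfl)
  naturality V W f := by
    apply Sh.hom_ext
    intro p
    exact Subtype.ext (Prod.ext rfl (Subtype.ext (Prod.ext rfl (transMap_naturality α f _ _ _))))

lemma restrictObj_comp (α : Sh.inverseImage Φ ⟶ Sh.inverseImage Ψ)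
    (β : Sh.inverseImage Ψ ⟶ Sh.inverseImage Θ) :
    restrictObj α ≫ restrictObj β = restrictObj (α ≫ β) := by
  apply NatTrans.ext
  funext W
  apply Sh.hom_ext
  intro p
  exact Subtype.ext (Prod.ext rfl (Subtype.ext (Prod.ext rfl (transMap_comp α β W _ _ _).symm)))

lemma restrictObj_id : restrictObj (𝟙 (Sh.inverseImage Φ)) = 𝟙 _ := by
  apply NatTrans.ext
  funext W
  apply Sh.hom_ext
  rintro ⟨⟨x, ⟨⟨y, w⟩, e⟩⟩, e'⟩
  exact Subtype.ext (Prod.ext rfl (Subtype.ext (Prod.ext e' rfl)))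

/-- This fills the cone with legs `Sh(Φ₀)` and `Sh(Ψ₀)` over `u_Y` to which the bi-pullback property
is applied; an object of `CategoricalPullback` requires an isomorphism here. -/
def restrictObjIso (α : Sh.inverseImage Φ ≅ Sh.inverseImage Ψ) :
    Sh.inverseImage (fromObj Y) ⋙ Sh.inverseImage (discMap Φ.obj Φ.continuous_obj) ≅
      Sh.inverseImage (fromObj Y) ⋙ Sh.inverseImage (discMap Ψ.obj Ψ.continuous_obj) where
  hom := restrictObj α.hom
  inv := restrictObj α.inv
  hom_inv_id := by rw [restrictObj_comp, α.hom_inv_id, restrictObj_id]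
  inv_hom_id := by rw [restrictObj_comp, α.inv_hom_id, restrictObj_id]

end Restrict

/-! ### Evaluating transformations on local sections. -/

section Evaluation

variable {S Z B : Type u} [TopologicalSpace S] [TopologicalSpace Z] [TopologicalSpace B]

/-- A section of a sheaf on `Y` over an open set of objects, as a morphism over that space. -/
def objSection (W : Sh Y) {U : Set Y.Obj} (hU : IsOpen U) (σ : U → W) (hσ : Continuous σ)
    (hp : ∀ z, W.proj (σ z) = z.1) :
    Sh.openSheaf U hU ⟶ (Sh.inverseImage (fromObj Y)).obj W :=
  Sh.sectionHom (Sh.invObj (fromObj Y) W) hU (fun z => ⟨(z.1, σ z), (hp z).symm⟩)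
    (Continuous.subtype_mk (.prodMk continuous_subtype_val hσ) _) (fun _ => rfl)

/-- The canonical map from an open set to the pullback of an open set containing its image. -/
def openToPullback {f : Z → B} (hf : Continuous f) {E : Set Z} (hE : IsOpen E) {U : Set B}
    (hU : IsOpen U) (h : ∀ z ∈ E, f z ∈ U) :
    Sh.openSheaf E hE ⟶ (Sh.inverseImage (discMap f hf)).obj (Sh.openSheaf U hU) :=
  Sh.sectionHom (Sh.invObj (discMap f hf) (Sh.openSheaf U hU)) hE
    (fun z => ⟨(z.1, ⟨f z.1, h z.1 z.2⟩), rfl⟩)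
    (Continuous.subtype_mk (.prodMk continuous_subtype_val
      (Continuous.subtype_mk (hf.comp continuous_subtype_val) _)) _) (fun _ => rfl)

/-- A transformation from the composite of `h` and `f` to the inverse image along `φ` takes the
pullback of a section to the value of that section. -/
lemma app_map_section (h : GeomMorphism (Sh (disc S)) (Sh (disc Z)))
    {f : Z → B} (hf : Continuous f) {φ : S → B} (hφ : Continuous φ)
    (β : Sh.inverseImage (discMap f hf) ⋙ h.inv ⟶ Sh.inverseImage (discMap φ hφ))
    {W : Sh (disc B)} {E : Set Z} (hE : IsOpen E) {U : Set B} (hU : IsOpen U)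
    (hEU : ∀ z ∈ E, f z ∈ U) (σ : Sh.openSheaf U hU ⟶ W) (e : h.inv.obj (Sh.openSheaf E hE)) {x : S}
    (hx : (h.inv.obj (Sh.openSheaf E hE)).proj e = x) (hxU : φ x ∈ U) :
    Sh.Hom.toFun (β.app W) (Sh.Hom.toFun (h.inv.map (openToPullback hf hE hU hEU ≫
      (Sh.inverseImage (discMap f hf)).map σ)) e) =
      (⟨(x, Sh.Hom.toFun σ ⟨φ x, hxU⟩), (Sh.Hom.proj_toFun σ ⟨φ x, hxU⟩).symm⟩ :
        (Sh.invObj (discMap φ hφ) W).carrier) := by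
  let e' : (h.inv.obj ((Sh.inverseImage (discMap f hf)).obj (Sh.openSheaf U hU))).carrier :=
    Sh.Hom.toFun (h.inv.map (openToPullback hf hE hU hEU)) e
  let p : (Sh.invObj (discMap φ hφ) (Sh.openSheaf U hU)).carrier :=
    Sh.Hom.toFun (β.app (Sh.openSheaf U hU)) e'
  have h1 : p.1.1 = x := ((Sh.Hom.proj_toFun (β.app (Sh.openSheaf U hU)) e').trans
    (Sh.Hom.proj_toFun (h.inv.map (openToPullback hf hE hU hEU)) e)).trans hx
  have h2 : φ p.1.1 = p.1.2.1 := p.2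
  -- The pullback of `U` along `φ` has at most one point over `x`, so `β` has no freedom on `U`;
  -- naturality in `σ` transfers this to `W`.
  have hp : p = ⟨(x, ⟨φ x, hxU⟩), rfl⟩ :=
    Subtype.ext (Prod.ext h1 (Subtype.ext (h2.symm.trans (congrArg φ h1))))
  rw [Functor.map_comp, Sh.comp_toFun]
  have h3 := congrArg (fun m : h.inv.obj ((Sh.inverseImage (discMap f hf)).obj (Sh.openSheaf U hU))
    ⟶ (Sh.inverseImage (discMap φ hφ)).obj W => Sh.Hom.toFun m e') (β.naturality σ)
  refine h3.trans ?_
  change Sh.Hom.toFun ((Sh.inverseImage (discMap φ hφ)).map σ) p = _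
  rw [hp]
  rfl

end Evaluation

/-! ### Arrows from isomorphisms of inverse images, and the conclusion. -/

/-- The set of arrows which take one local section of a sheaf to another one is open. -/
lemma isOpen_act_eq (W : Sh Y) {U V : Set Y.Obj} (hU : IsOpen U) (hV : IsOpen V)
    {σ : U → W} {τ : V → W} (hσ : Continuous σ) (hτ : Continuous τ)
    (hpσ : ∀ z, W.proj (σ z) = z.1) (hpτ : ∀ z, W.proj (τ z) = z.1) :
    IsOpen {g : Y.Arr | ∃ (hs : Y.src g ∈ U) (ht : Y.tgt g ∈ V),
      W.act g (σ ⟨Y.src g, hs⟩) (hpσ ⟨Y.src g, hs⟩).symm = τ ⟨Y.tgt g, ht⟩} := by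
  let G : Set Y.Arr := Y.src ⁻¹' U ∩ Y.tgt ⁻¹' V
  have hG : IsOpen G := (hU.preimage Y.continuous_src).inter (hV.preimage Y.continuous_tgt)
  let a : G → W := fun g => W.act g.1 (σ ⟨Y.src g.1, g.2.1⟩) (hpσ ⟨Y.src g.1, g.2.1⟩).symm
  let b : G → W := fun g => τ ⟨Y.tgt g.1, g.2.2⟩
  have ha : Continuous a := W.continuous_act' continuous_subtype_val
    (hσ.comp (Continuous.subtype_mk (Y.continuous_src.comp continuous_subtype_val) _)) _
  have hb : Continuous b :=
    hτ.comp (Continuous.subtype_mk (Y.continuous_tgt.comp continuous_subtype_val) _)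
  -- Both maps lift the target map through the local homeomorphism `W.proj`, so they agree on an
  -- open set.
  have hopen : IsOpen {g | a g = b g} :=
    W.str.isLocalHomeomorph_proj.isLocallyInjective.isOpen_eqLocus ha hb
      (funext fun g => (W.str.proj_act _ _ _).trans (hpτ ⟨Y.tgt g.1, g.2.2⟩).symm)
  convert hG.isOpenMap_subtype_val _ hopen using 1
  ext g
  constructor
  · rintro ⟨hs, ht, h⟩
    exact ⟨⟨g, hs, ht⟩, h, rfl⟩
  · rintro ⟨⟨g, hs, ht⟩, h, rfl⟩
    exact ⟨hs, ht, h⟩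

/-- An isomorphism of inverse images is given by a continuous family of arrows if the target is
étale complete. -/
lemma IsEtaleComplete.exists_arrows (hY : Y.IsEtaleComplete) {Φ Ψ : ContFunctor X Y}
    (α : Sh.inverseImage Φ ≅ Sh.inverseImage Ψ) :
    ∃ (k : X.Obj → Y.Arr) (_ : Continuous k) (hs : ∀ x, Y.src (k x) = Φ.obj x)
      (_ : ∀ x, Y.tgt (k x) = Ψ.obj x), ∀ (W : Sh Y) (x : X.Obj) (w : W) (e : Φ.obj x = W.proj w),
        transMap α.hom W x w e = W.act (k x) w ((hs x).trans e) := by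
  have := hY.t0_obj
  have := hY.quasiSober_arr
  have := hY.isEquivalence_toCone X.Obj
  let F := GeomMorphism.toConeFunctor (Sh (disc X.Obj)) (squareIso Y)
  let c : CategoricalPullback (GeomMorphism.postcomp (Sh (disc X.Obj)) (shGeom (fromObj Y)))
      (GeomMorphism.postcomp (Sh (disc X.Obj)) (shGeom (fromObj Y))) :=
    { fst := shGeom (discMap Φ.obj Φ.continuous_obj)
      snd := shGeom (discMap Ψ.obj Ψ.continuous_obj)
      iso := GeomMorphism.isoMk (restrictObjIso α) }
  -- Essential surjectivity of the comparison functor; `β` and `γ` are the legs of the resulting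
  -- isomorphism of cones.
  let h := F.objPreimage c
  let i : F.obj h ≅ c := F.objObjPreimageIso c
  let β : h.comp (shGeom (discMap Y.src Y.continuous_src)) ≅
    shGeom (discMap Φ.obj Φ.continuous_obj) := (CategoricalPullback.π₁ _ _).mapIso i
  let γ : h.comp (shGeom (discMap Y.tgt Y.continuous_tgt)) ≅
    shGeom (discMap Ψ.obj Ψ.continuous_obj) := (CategoricalPullback.π₂ _ _).mapIso i
  obtain ⟨k, hkc, hk⟩ := Sh.exists_continuous_of_geomMorphism h
  have hs : ∀ x, Y.src (k x) = Φ.obj x :=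
    Sh.comp_eq_of_iso h hk Y.continuous_src Φ.continuous_obj β
  have ht : ∀ x, Y.tgt (k x) = Ψ.obj x :=
    Sh.comp_eq_of_iso h hk Y.continuous_tgt Ψ.continuous_obj γ
  refine ⟨k, hkc, hs, ht, fun W x w e => ?_⟩
  have hw : Y.src (k x) = W.proj w := (hs x).trans e
  obtain ⟨U, hU, hwU, σ, hσ, hpσ, hσw⟩ := Sh.exists_localSection W w
  obtain ⟨V, hV, hwV, τ, hτ, hpτ, hτw⟩ := Sh.exists_localSection W (W.act (k x) w hw)
  have hxU : Φ.obj x ∈ U := by rw [e]; exact hwU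
  have hxV : Ψ.obj x ∈ V := by
    rw [← ht x, ← W.str.proj_act (k x) w hw]
    exact hwV
  have hσx : σ ⟨Φ.obj x, hxU⟩ = w := (congrArg σ (Subtype.ext e)).trans hσw
  have hτx : τ ⟨Ψ.obj x, hxV⟩ = W.act (k x) w hw :=
    (congrArg τ (Subtype.ext ((ht x).symm.trans (W.str.proj_act (k x) w hw).symm))).trans hτw
  -- The arrows carrying `σ` to `τ`. They include `k x` because `τ` was chosen through `k x · w`, so
  -- the inverse image of `E` under `h` has a point `e₀` over `x`.
  let E : Set Y.Arr := {g | ∃ (hs : Y.src g ∈ U) (ht : Y.tgt g ∈ V),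
    W.act g (σ ⟨Y.src g, hs⟩) (hpσ ⟨Y.src g, hs⟩).symm = τ ⟨Y.tgt g, ht⟩}
  have hE : IsOpen E := isOpen_act_eq W hU hV hσ hτ hpσ hpτ
  have hxE : k x ∈ E := by
    refine ⟨(hs x).symm ▸ hxU, (ht x).symm ▸ hxV, ?_⟩
    refine (Sh.act_congr W rfl ((congrArg σ (Subtype.ext (hs x))).trans hσx) _ hw).trans ?_
    exact hτx.symm.trans (congrArg τ (Subtype.ext (ht x).symm))
  obtain ⟨e₀, he₀⟩ := (hk E hE x).1 hxE
  have hEU : ∀ g ∈ E, Y.src g ∈ U := fun g hg => hg.1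
  have hEV : ∀ g ∈ E, Y.tgt g ∈ V := fun g hg => hg.2.1
  let m₁ := openToPullback Y.continuous_src hE hU hEU ≫
    (Sh.inverseImage (discMap Y.src Y.continuous_src)).map (objSection W hU σ hσ hpσ)
  let m₂ := openToPullback Y.continuous_tgt hE hV hEV ≫
    (Sh.inverseImage (discMap Y.tgt Y.continuous_tgt)).map (objSection W hV τ hτ hpτ)
  -- Over `E` the 2-cell `(g, w) ↦ (g, g · w)` takes the pullback of `σ` along the source to the
  -- pullback of `τ` along the target, by the definition of `E`.
  have hm : m₁ ≫ NatTrans.app (squareIso Y).hom W = m₂ := by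
    apply Sh.hom_ext
    rintro ⟨g, h1, h2, h3⟩
    exact Subtype.ext (Prod.ext rfl (Subtype.ext (Prod.ext rfl h3)))
  have e₁ := app_map_section h Y.continuous_src Φ.continuous_obj β.hom hE hU hEU
    (objSection W hU σ hσ hpσ) e₀ he₀ hxU
  have e₂ := app_map_section h Y.continuous_tgt Ψ.continuous_obj γ.hom hE hV hEV
    (objSection W hV τ hτ hpτ) e₀ he₀ hxV
  let s₀ := Sh.Hom.toFun (h.inv.map m₁) e₀
  -- Compatibility of `β` and `γ` with the 2-cells, at the point of `h.inv` given by `σ` and `e₀`.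
  -- By `e₁` and `e₂` its two sides become `α` applied to `σ (Φ x)` and `τ (Ψ x)`.
  have hcone : Sh.Hom.toFun (NatTrans.app (restrictObj α.hom) W)
      (Sh.Hom.toFun (NatTrans.app β.hom ((Sh.inverseImage (fromObj Y)).obj W)) s₀) =
      Sh.Hom.toFun (NatTrans.app γ.hom ((Sh.inverseImage (fromObj Y)).obj W))
        (Sh.Hom.toFun (h.inv.map (NatTrans.app (squareIso Y).hom W)) s₀) :=
    congrArg (fun m => Sh.Hom.toFun (NatTrans.app m W) s₀) i.hom.w
  have hs₀ : Sh.Hom.toFun (h.inv.map (NatTrans.app (squareIso Y).hom W)) s₀ =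
      Sh.Hom.toFun (h.inv.map m₂) e₀ :=
    congrArg (fun m => Sh.Hom.toFun m e₀) ((h.inv.map_comp m₁ _).symm.trans (congrArg h.inv.map hm))
  have hfinal := ((congrArg (Sh.Hom.toFun (NatTrans.app (restrictObj α.hom) W)) e₁).symm.trans
    hcone).trans ((congrArg _ hs₀).trans e₂)
  have hval : transMap α.hom W x (σ ⟨Φ.obj x, hxU⟩) (hpσ ⟨Φ.obj x, hxU⟩).symm =
      τ ⟨Ψ.obj x, hxV⟩ :=
    congrArg (fun p : (Sh.invObj (discMap Ψ.obj Ψ.continuous_obj)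
      (Sh.invObj (fromObj Y) W)).carrier => p.1.2.1.2) hfinal
  rw [← hτx, ← hval]
  congr 1
  exact hσx.symm

/-- Transformations of inverse images are equivariant. -/
lemma transMap_act {Φ Ψ : ContFunctor X Y} (α : Sh.inverseImage Φ ⟶ Sh.inverseImage Ψ) (W : Sh Y)
    (g : X.Arr) (w : W) (e : Φ.obj (X.src g) = W.proj w) :
    transMap α W (X.tgt g) (W.act (Φ.arr g) w ((Φ.src_arr g).trans e))
        ((Φ.tgt_arr g).symm.trans (W.str.proj_act _ _ _).symm) =
      W.act (Ψ.arr g) (transMap α W (X.src g) w e)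
        ((Ψ.src_arr g).trans (proj_transMap α W _ w e)) :=
  congrArg (fun p : (Sh.invObj Ψ W).carrier => p.1.2)
    (Sh.Hom.map_act (α.app W) g (⟨(X.src g, w), e⟩ : (Sh.invObj Φ W).carrier) rfl)

/-- Every isomorphism of inverse images is induced by a continuous transformation if the target is
étale complete. -/
lemma IsEtaleComplete.exists_inverseImageMap_eq (hY : Y.IsEtaleComplete) {Φ Ψ : ContFunctor X Y}
    (α : Sh.inverseImage Φ ≅ Sh.inverseImage Ψ) :
    ∃ a : ContTrans Φ Ψ, Sh.inverseImageMap a = α.hom := by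
  obtain ⟨k, hk, hs, ht, hact⟩ := hY.exists_arrows α
  refine ⟨⟨k, hs, ht, fun g => ?_, hk⟩, ?_⟩
  -- Naturality is an equation between parallel arrows of `Y`, so it can be checked on sheaves,
  -- where it is the equivariance of `α`.
  · refine hY.arr_ext (by simp [hs]) (by simp [ht]) fun W w e => ?_
    have e' : Φ.obj (X.src g) = W.proj w := by
      rw [← Φ.src_arr g, ← e, Y.src_comp]
    have h := transMap_act α.hom W g w e'
    rw [hact] at h
    refine (W.str.act_comp _ _ _ _ _).symm.trans (h.trans ?_)
    refine (Sh.act_congr W rfl (hact W _ w e') _ ?_).trans (W.str.act_comp _ _ _ _ _)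
    simp [ht]
  · apply NatTrans.ext
    funext W
    apply Sh.hom_ext
    intro p
    refine Subtype.ext (Eq.trans ?_ (toFun_eq_transMap α.hom W p).symm)
    exact Prod.ext rfl (hact W p.1.1 p.1.2 p.2).symm

/-- A continuous transformation is determined by its action on sheaves if the target is étale
complete. -/
lemma IsEtaleComplete.inverseImageMap_injective (hY : Y.IsEtaleComplete) {Φ Ψ : ContFunctor X Y}
    {a b : ContTrans Φ Ψ} (h : Sh.inverseImageMap a = Sh.inverseImageMap b) : a = b := by
  apply ContTrans.ext
  funext x
  refine hY.arr_ext ((a.src_app x).trans (b.src_app x).symm)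
    ((a.tgt_app x).trans (b.tgt_app x).symm) fun W w e => ?_
  exact congrArg (fun α => transMap α W x w ((a.src_app x).symm.trans e)) h

end TopGrpd

theorem mainTheorem5 (X Y : TopGrpd.{u}) (hX : X.IsEtaleComplete) (hY : Y.IsEtaleComplete) :
    (TopGrpd.shIso X Y).Full ∧ (TopGrpd.shIso X Y).Faithful := by
  refine ⟨⟨fun {Φ Ψ} f => ?_⟩, ⟨fun {Φ Ψ a b} h => ?_⟩⟩
  -- Morphisms of geometric morphisms are by definition transformations of inverse images, so the
  -- isomorphism carried by `f` is repackaged as one of functors.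
  · let α : TopGrpd.Sh.inverseImage Φ ≅ TopGrpd.Sh.inverseImage Ψ :=
      ⟨f.iso.hom, f.iso.inv, f.iso.hom_inv_id, f.iso.inv_hom_id⟩
    obtain ⟨a, ha⟩ := hY.exists_inverseImageMap_eq α
    exact ⟨a, CoreHom.ext (Iso.ext ha)⟩
  · exact hY.inverseImageMap_injective (congrArg (fun f => f.iso.hom) h)
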